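/- For $E\subset\mathbb R^d$ and $x\in\mathbb R^d$ let $\pi_x(E)=\left\{\frac{x-y}{|x-y|} : y\in E,\ y\neq x\right\}\subset\mathbb S^{d-1}$ be the radial projection of $E$ from $x$. For a finite Borel measure $\mu$ on $\mathbb R^d$ put $\widehat\mu(\xi)=\int e^{-2\pi i y\cdot\xi}\,d\mu(y)$. A set $E\subset\mathbb R^d$ is called a Salem set if for every $s$ with $0<s<\dim_{\mathcal H}E$ there is a nonzero finite Borel measure $\mu$ on $\mathbb R^d$ with compact support contained in $E$ such that $|\widehat\mu(\xi)|\le|\xi|^{-s/2}$ for all $\xi\in\mathbb R^d\setminus\{0\}$. Here $\dim_{\mathcal H}$ is the Hausdorff dimension and $H^1$ is the one-dimensional Hausdorff (outer) measure. Theorem 1.5. Let $E\subset\mathbb R^2$ be a Salem set, and let $\alpha$ be a real number with $\dim_{\mathcal H}E>\alpha$. Then $$\dim_{\mathcal H}\{x\in\mathbb R^2 : H^1(\pi_x(E))=0\}\le 4-2\alpha.$$ In particular, if $\dim_{\mathcal H}E>\tfrac43$, then there exists $x\in E$ such that $H^1(\pi_x(E))>0$. -/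

import Mathlib

open MeasureTheory
open scoped MeasureTheory ENNReal

noncomputable section

/-- The Fourier transform of a measure on `ℝᵈ`:
`μ̂(ξ) = ∫ exp(-2πi y·ξ) dμ(y)`. -/
def measureFourier {d : ℕ} (μ : Measure (EuclideanSpace ℝ (Fin d)))
    (ξ : EuclideanSpace ℝ (Fin d)) : ℂ :=
  ∫ y, Complex.exp (-(2 * Real.pi * (inner ℝ y ξ : ℝ) : ℝ) * Complex.I) ∂μ

/-- `E ⊆ ℝᵈ` is a Salem set: for every `0 < s < dim_H E` there is a nonzero finite Borel measure
`μ` with compact support contained in `E` such that `|μ̂(ξ)| ≤ |ξ|^(-s/2)` for all `ξ ≠ 0`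
(at `ξ = 0` the right-hand side is `+∞`). -/
def IsSalemSet {d : ℕ} (E : Set (EuclideanSpace ℝ (Fin d))) : Prop :=
  ∀ s : ℝ, 0 < s → ENNReal.ofReal s < dimH E →
    ∃ μ : Measure (EuclideanSpace ℝ (Fin d)),
      IsFiniteMeasure μ ∧ μ ≠ 0 ∧ IsCompact μ.support ∧ μ.support ⊆ E ∧
        ∀ ξ : EuclideanSpace ℝ (Fin d), ξ ≠ 0 → ‖measureFourier μ ξ‖ ≤ ‖ξ‖ ^ (-s / 2)

/-- The radial projection `π_x(E) = {(x - y)/|x - y| : y ∈ E, y ≠ x}`, a subset of the unit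
sphere. -/
def radialProjection {d : ℕ} (x : EuclideanSpace ℝ (Fin d))
    (E : Set (EuclideanSpace ℝ (Fin d))) : Set (EuclideanSpace ℝ (Fin d)) :=
  (fun y => ‖x - y‖⁻¹ • (x - y)) '' (E \ {x})

end

/-! ### Projections of a measure, their Fourier transforms and smoothed energies -/

noncomputable section

open Real Set Filter Topology

/-! Only `1 < α` matters, since the plane has dimension 2. Take `α < s < dim E` and a measure `μ` on
`E` whose transform decays like `|ξ|^(-s/2)`. For fixed `x`, `gaussProj` at scale `δ` is comparable,
up to Gaussian tails, to `δ⁻¹` times the mass of the `δ`-strip around the line through `x`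
orthogonal to `(cos θ, sin θ)`; `radialEnergy` is its squared `L²` norm in `θ`.

Null projections force large energy. Away from `x`, the strips carry mass at least of order `δ`
after integration in `θ`. If the radial projection is null, the directions whose strip meets a
compact part of the support have measure tending to 0, so by Cauchy–Schwarz the energy tends to
infinity (`tendsto_radialEnergy_atTop`). Then the increments from scale `δ` to `δ / 2`, with `δ =
2^(-j)`, exceed `δ^ε` infinitely often.

Large increments are rare. Take `N` points, one per grid cell of side `δ`, with increments at least
`r`. On the Fourier side the sum of the increments pairs the transforms at frequencies `u`, `v` with
the exponential sum of the points at `u + v`. Fourier decay leaves `δ^β`, `β = s - 1 - ε`, times the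
`L¹` norm of that sum, essentially over `|w| ≲ 1/δ`. Weighted AM–GM replaces it by an `L²` norm with
weight `|w|`, which after integration in `θ` is a planar integral in polar coordinates; the
exponentials are almost orthogonal there, so it is `O(N δ^(-2))`. Optimising the weight gives `N ≲
δ^(2β-2-ε) / r²` (`exists_card_bound`). With `r = δ^ε` the count is `δ^(-(4-2s+5ε))`, and covering
the limsup set (`dimH_frequently_mem_le`) gives the dimension bound. -/

/-- The Euclidean plane. -/
abbrev Plane := EuclideanSpace ℝ (Fin 2)

/-- The coordinate of `y` in the direction `(cos θ, sin θ)`. -/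
def dirCoord (θ : ℝ) (y : Plane) : ℝ := y 0 * cos θ + y 1 * sin θ

lemma continuous_dirCoord : Continuous fun q : ℝ × Plane => dirCoord q.1 q.2 := by
  unfold dirCoord; fun_prop

@[fun_prop] lemma Continuous.dirCoord {X : Type*} [TopologicalSpace X] {f : X → ℝ} {g : X → Plane}
    (hf : Continuous f) (hg : Continuous g) : Continuous fun x => dirCoord (f x) (g x) :=
  continuous_dirCoord.comp (hf.prodMk hg)

lemma dirCoord_sub (θ : ℝ) (y z : Plane) : dirCoord θ (y - z) = dirCoord θ y - dirCoord θ z := by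
  simp [dirCoord]; ring

/-- The unit vector `(cos θ, sin θ)`. -/
def dirVec (θ : ℝ) : Plane := !₂[cos θ, sin θ]

lemma norm_dirVec (θ : ℝ) : ‖dirVec θ‖ = 1 := by
  simp [dirVec, EuclideanSpace.norm_eq]

lemma inner_smul_dirVec (y : Plane) (w θ : ℝ) : inner ℝ y (w • dirVec θ) = w * dirCoord θ y := by
  simp [dirVec, dirCoord, PiLp.inner_apply, Fin.sum_univ_two]; ring

/-- The Fourier transform of the projection of `μ` onto the line in direction `θ`. -/
def projFourier (μ : Measure Plane) (θ w : ℝ) : ℂ := measureFourier μ (w • dirVec θ)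

lemma projFourier_eq (μ : Measure Plane) (θ w : ℝ) :
    projFourier μ θ w = ∫ y, Complex.exp (-(2 * π * (w * dirCoord θ y) : ℝ) * Complex.I) ∂μ := by
  simp only [projFourier, measureFourier, inner_smul_dirVec]

/-- The density at `dirCoord θ x` of the projection of `μ` to the line in direction `θ`,
smoothed by a Gaussian at scale `δ`. -/
def gaussProj (μ : Measure Plane) (δ θ : ℝ) (x : Plane) : ℝ :=
  ∫ y, δ⁻¹ * exp (-π * (dirCoord θ y - dirCoord θ x) ^ 2 / δ ^ 2) ∂μ

/-- The smoothed energy of the radial projection of `μ` from `x`. -/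
def radialEnergy (μ : Measure Plane) (δ : ℝ) (x : Plane) : ℝ :=
  ∫ θ in Ioo (-π) π, gaussProj μ δ θ x ^ 2

section
variable {μ : Measure Plane} [IsFiniteMeasure μ]

lemma norm_projFourier_le (θ w : ℝ) : ‖projFourier μ θ w‖ ≤ μ.real univ := by
  rw [projFourier_eq]
  refine (norm_integral_le_of_norm_le_const (C := 1) (.of_forall fun y => ?_)).trans (by simp)
  rw [← Complex.ofReal_neg, Complex.norm_exp_ofReal_mul_I]

lemma continuous_projFourier : Continuous fun q : ℝ × ℝ => projFourier μ q.1 q.2 := by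
  simp only [projFourier_eq]
  refine continuous_of_dominated (bound := fun _ => 1) ?_ ?_ (integrable_const _) ?_
  · intro q
    exact (Continuous.aestronglyMeasurable (by fun_prop))
  · intro q
    refine .of_forall fun y => ?_
    rw [← Complex.ofReal_neg, Complex.norm_exp_ofReal_mul_I]
  · refine .of_forall fun y => ?_
    fun_prop

lemma integrable_gaussProj {δ : ℝ} (hδ : 0 < δ) (θ : ℝ) (x : Plane) :
    Integrable (fun y => δ⁻¹ * exp (-π * (dirCoord θ y - dirCoord θ x) ^ 2 / δ ^ 2)) μ := by
  refine Integrable.of_bound (C := δ⁻¹) (Continuous.aestronglyMeasurable (by fun_prop))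
    (.of_forall fun y => ?_)
  rw [Real.norm_of_nonneg (by positivity)]
  refine mul_le_of_le_one_right (by positivity) (exp_le_one_iff.2 ?_)
  rw [neg_mul, neg_div, neg_nonpos]; positivity

lemma continuous_gaussProj {δ : ℝ} (hδ : 0 < δ) (x : Plane) :
    Continuous fun θ => gaussProj μ δ θ x := by
  refine continuous_of_dominated (bound := fun _ => δ⁻¹) ?_ ?_ (integrable_const _) ?_
  · intro θ
    exact (Continuous.aestronglyMeasurable (by fun_prop))
  · intro q
    refine .of_forall fun y => ?_
    rw [Real.norm_of_nonneg (by positivity)]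
    refine mul_le_of_le_one_right (by positivity) (exp_le_one_iff.2 ?_)
    rw [neg_mul, neg_div, neg_nonpos]; positivity
  · refine .of_forall fun y => ?_
    fun_prop

lemma integrableOn_gaussProj_sq {δ : ℝ} (hδ : 0 < δ) (x : Plane) :
    IntegrableOn (fun θ => gaussProj μ δ θ x ^ 2) (Ioo (-π) π) :=
  (((continuous_gaussProj hδ x).pow 2).integrableOn_Icc).mono_set Ioo_subset_Icc_self

lemma integral_gauss_mul_exp {δ : ℝ} (hδ : 0 < δ) (v : ℝ) :
    ∫ w : ℝ, Complex.exp ((2 * π * (w * v) : ℝ) * Complex.I) * (exp (-π * δ ^ 2 * w ^ 2) : ℝ) =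
      (δ⁻¹ * exp (-π * v ^ 2 / δ ^ 2) : ℝ) := by
  have hb : 0 < ((π * δ ^ 2 : ℝ) : ℂ).re := by
    rw [Complex.ofReal_re]; positivity
  have h := fourierIntegral_gaussian hb ((2 * π * v : ℝ) : ℂ)
  have e1 : ((π : ℂ) / ((π * δ ^ 2 : ℝ) : ℂ)) ^ (1 / 2 : ℂ) = ((δ⁻¹ : ℝ) : ℂ) := by
    rw [← Complex.ofReal_div]
    have : π / (π * δ ^ 2) = δ⁻¹ ^ 2 := by field_simp
    rw [this, show (1 / 2 : ℂ) = ((1 / 2 : ℝ) : ℂ) by simp,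
      ← Complex.ofReal_cpow (by positivity), ← Real.sqrt_eq_rpow, Real.sqrt_sq (by positivity)]
  rw [e1] at h
  have e2 : Complex.exp (-((2 * π * v : ℝ) : ℂ) ^ 2 / (4 * ((π * δ ^ 2 : ℝ) : ℂ)))
      = ((exp (-π * v ^ 2 / δ ^ 2) : ℝ) : ℂ) := by
    rw [Complex.ofReal_exp]
    congr 1
    have : (π : ℂ) ≠ 0 := by exact_mod_cast pi_ne_zero
    have : (δ : ℂ) ≠ 0 := by exact_mod_cast hδ.ne'
    push_cast
    field_simp
    ring
  rw [e2] at h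
  rw [Complex.ofReal_mul, ← h]
  congr 1
  ext w
  push_cast
  congr 2 <;> ring

lemma integrable_gauss {δ : ℝ} (hδ : 0 < δ) : Integrable fun w : ℝ => exp (-π * δ ^ 2 * w ^ 2) := by
  have := integrable_exp_neg_mul_sq (b := π * δ ^ 2) (by positivity)
  simpa only [neg_mul] using this

/-- The integrand in the Fourier representation of `gaussProj`. -/
def gaussFourier (μ : Measure Plane) (δ θ : ℝ) (w : ℝ) : ℂ :=
  (exp (-π * δ ^ 2 * w ^ 2) : ℝ) * projFourier μ θ w

lemma norm_exp_mul_I_one (a : ℝ) : ‖Complex.exp ((a : ℂ) * Complex.I)‖ = 1 :=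
  Complex.norm_exp_ofReal_mul_I a

lemma integrable_gaussFourier_mul {δ : ℝ} (hδ : 0 < δ) (θ t : ℝ) :
    Integrable fun w : ℝ =>
      gaussFourier μ δ θ w * Complex.exp ((2 * π * (w * t) : ℝ) * Complex.I) := by
  refine Integrable.mono' ((integrable_gauss hδ).mul_const (μ.real univ)) ?_
    (.of_forall fun w => ?_)
  · unfold gaussFourier
    have := (continuous_projFourier (μ := μ)).comp (Continuous.prodMk_right θ)
    simp only [Function.comp_def] at this
    exact (Continuous.aestronglyMeasurable (by fun_prop))
  · rw [norm_mul, norm_exp_mul_I_one, mul_one, gaussFourier, norm_mul, Complex.norm_real,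
      Real.norm_of_nonneg (exp_pos _).le]
    gcongr
    exact norm_projFourier_le θ w

/-- Fourier inversion by hand: each Gaussian bump is the integral of its own transform, and Fubini
moves the integral over `μ` inside. -/
lemma gaussProj_eq_integral {δ : ℝ} (hδ : 0 < δ) (θ : ℝ) (x : Plane) :
    (gaussProj μ δ θ x : ℂ) = ∫ w : ℝ,
      gaussFourier μ δ θ w * Complex.exp ((2 * π * (w * dirCoord θ x) : ℝ) * Complex.I) := by
  rw [gaussProj, ← integral_complex_ofReal]
  have h1 : ∀ y : Plane, ((δ⁻¹ * exp (-π * (dirCoord θ y - dirCoord θ x) ^ 2 / δ ^ 2) : ℝ) : ℂ) =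
      ∫ w : ℝ, Complex.exp ((2 * π * (w * (dirCoord θ x - dirCoord θ y)) : ℝ) * Complex.I) *
        (exp (-π * δ ^ 2 * w ^ 2) : ℝ) := by
    intro y
    rw [integral_gauss_mul_exp hδ]
    congr 5
    ring
  simp_rw [h1]
  rw [integral_integral_swap]
  · congr 1
    ext w
    rw [gaussFourier, projFourier_eq, ← integral_const_mul, ← integral_mul_const]
    congr 1
    ext y
    rw [mul_comm, mul_assoc (Complex.ofReal _), ← Complex.exp_add]
    congr 2
    push_cast
    ring
  · refine Integrable.mono' (g := fun q : Plane × ℝ => (1 : ℝ) * exp (-π * δ ^ 2 * q.2 ^ 2))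
      ((integrable_const (1 : ℝ)).mul_prod (integrable_gauss hδ)) ?_ (.of_forall fun q => ?_)
    · exact Continuous.aestronglyMeasurable (by unfold Function.uncurry; fun_prop)
    · rw [Function.uncurry, norm_mul, norm_exp_mul_I_one, Complex.norm_real,
        Real.norm_of_nonneg (exp_pos _).le]

end

/-! ### Energy increments on the Fourier side -/

/-- The exponential sum with frequencies `t i`, `i ∈ T`. -/
def expSum {ι : Type*} (T : Finset ι) (t : ι → ℝ) (w : ℝ) : ℂ :=
  ∑ i ∈ T, Complex.exp ((2 * π * (w * t i) : ℝ) * Complex.I)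

lemma norm_expSum_le {ι : Type*} (T : Finset ι) (t : ι → ℝ) (w : ℝ) :
    ‖expSum T t w‖ ≤ T.card :=
  (norm_sum_le _ _).trans (by simp only [norm_exp_mul_I_one]; simp)

section
variable {μ : Measure Plane} [IsFiniteMeasure μ]

/-- The density is real, so it is squared without conjugation. The point `x` then enters only
through a phase at frequency `z.1 + z.2`, and summation over points produces `expSum` there. -/
lemma gaussProj_sq_eq_integral {δ : ℝ} (hδ : 0 < δ) (θ : ℝ) (x : Plane) :
    Integrable (fun z : ℝ × ℝ => gaussFourier μ δ θ z.1 * gaussFourier μ δ θ z.2 *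
        Complex.exp ((2 * π * ((z.1 + z.2) * dirCoord θ x) : ℝ) * Complex.I)) ∧
    ((gaussProj μ δ θ x ^ 2 : ℝ) : ℂ) = ∫ z : ℝ × ℝ,
      gaussFourier μ δ θ z.1 * gaussFourier μ δ θ z.2 *
        Complex.exp ((2 * π * ((z.1 + z.2) * dirCoord θ x) : ℝ) * Complex.I) := by
  have h : ∀ z : ℝ × ℝ, gaussFourier μ δ θ z.1 * gaussFourier μ δ θ z.2 *
        Complex.exp ((2 * π * ((z.1 + z.2) * dirCoord θ x) : ℝ) * Complex.I) =
      (gaussFourier μ δ θ z.1 * Complex.exp ((2 * π * (z.1 * dirCoord θ x) : ℝ) * Complex.I)) *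
      (gaussFourier μ δ θ z.2 * Complex.exp ((2 * π * (z.2 * dirCoord θ x) : ℝ) * Complex.I)) := by
    intro z
    rw [mul_mul_mul_comm (gaussFourier _ _ _ _), ← Complex.exp_add]
    congr 2
    push_cast
    ring
  simp_rw [h]
  refine ⟨(integrable_gaussFourier_mul hδ θ _).mul_prod (integrable_gaussFourier_mul hδ θ _), ?_⟩
  rw [Measure.volume_eq_prod, integral_prod_mul
    (fun w => gaussFourier μ δ θ w * Complex.exp ((2 * π * (w * dirCoord θ x) : ℝ) * Complex.I))
    (fun w => gaussFourier μ δ θ w * Complex.exp ((2 * π * (w * dirCoord θ x) : ℝ) * Complex.I)),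
    ← gaussProj_eq_integral hδ]
  push_cast
  ring

lemma enorm_sum_gaussProj_sq_sub_le {ι : Type*} (T : Finset ι) (x : ι → Plane) {δ δ' : ℝ}
    (hδ : 0 < δ) (hδ' : 0 < δ') (θ : ℝ) :
    ‖∑ i ∈ T, (gaussProj μ δ' θ (x i) ^ 2 - gaussProj μ δ θ (x i) ^ 2)‖ₑ ≤
      ∫⁻ z : ℝ × ℝ, ‖(gaussFourier μ δ' θ z.1 * gaussFourier μ δ' θ z.2 -
        gaussFourier μ δ θ z.1 * gaussFourier μ δ θ z.2) *
          expSum T (fun i => dirCoord θ (x i)) (z.1 + z.2)‖ₑ := by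
  have h : ((∑ i ∈ T, (gaussProj μ δ' θ (x i) ^ 2 - gaussProj μ δ θ (x i) ^ 2) : ℝ) : ℂ) =
      ∫ z : ℝ × ℝ, (gaussFourier μ δ' θ z.1 * gaussFourier μ δ' θ z.2 -
        gaussFourier μ δ θ z.1 * gaussFourier μ δ θ z.2) *
          expSum T (fun i => dirCoord θ (x i)) (z.1 + z.2) := by
    simp_rw [expSum, Finset.mul_sum, sub_mul]
    rw [integral_finsetSum, Complex.ofReal_sum]
    · refine Finset.sum_congr rfl fun i _ => ?_
      rw [integral_sub (gaussProj_sq_eq_integral hδ' θ (x i)).1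
        (gaussProj_sq_eq_integral hδ θ (x i)).1, Complex.ofReal_sub,
        (gaussProj_sq_eq_integral hδ' θ (x i)).2, (gaussProj_sq_eq_integral hδ θ (x i)).2]
    · exact fun i _ => (gaussProj_sq_eq_integral hδ' θ (x i)).1.sub
        (gaussProj_sq_eq_integral hδ θ (x i)).1
  refine le_trans (le_of_eq ?_) (enorm_integral_le_lintegral_enorm _)
  rw [← h, ← ofReal_norm, ← ofReal_norm, Complex.norm_real]

end

/-! ### Pointwise bounds for the increment kernel -/

lemma one_sub_exp_neg_le_rpow {a p : ℝ} (ha : 0 ≤ a) (hp : 0 ≤ p) (hp1 : p ≤ 1) :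
    1 - exp (-a) ≤ a ^ p := by
  rcases le_total a 1 with h | h
  · have h1 := Real.one_sub_le_exp_neg a
    have h2 : a ≤ a ^ p := by
      rcases ha.eq_or_lt with rfl | h0
      · exact rpow_nonneg le_rfl _
      · simpa using rpow_le_rpow_of_exponent_ge h0 h hp1
    linarith
  · have := one_le_rpow h hp
    have := exp_pos (-a)
    linarith

/-- Factor out the wider Gaussian. It keeps decay in `r + u` because `(r + u)² ≤ 2 (r² + u²)`; the
remaining factor is small at low frequency, which trades growth of order `β` in the frequencies for
a gain `δ^β`. -/
lemma gauss_sub_gauss_le {δ r u β : ℝ} (hδ : 0 < δ) (hβ : 0 ≤ β) (hβ2 : β ≤ 2) :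
    exp (-π * (δ / 2) ^ 2 * r ^ 2) * exp (-π * (δ / 2) ^ 2 * u ^ 2) -
      exp (-π * δ ^ 2 * r ^ 2) * exp (-π * δ ^ 2 * u ^ 2) ≤
    3 * δ ^ β * exp (-π * δ ^ 2 / 8 * (r + u) ^ 2) * ((1 + |r|) ^ β + (1 + |u|) ^ β) := by
  have e1 : exp (-π * (δ / 2) ^ 2 * r ^ 2) * exp (-π * (δ / 2) ^ 2 * u ^ 2) -
      exp (-π * δ ^ 2 * r ^ 2) * exp (-π * δ ^ 2 * u ^ 2) =
      exp (-π * δ ^ 2 / 4 * (r ^ 2 + u ^ 2)) * (1 - exp (-(3 * π / 4 * δ ^ 2 * (r ^ 2 + u ^ 2)))) := by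
    rw [mul_sub, ← exp_add, ← exp_add, ← exp_add]
    ring_nf
  have e2 : exp (-π * δ ^ 2 / 4 * (r ^ 2 + u ^ 2)) ≤ exp (-π * δ ^ 2 / 8 * (r + u) ^ 2) := by
    apply exp_le_exp.2
    have : 0 ≤ π * δ ^ 2 / 8 * (r - u) ^ 2 := by positivity
    linarith
  have e3 : 1 - exp (-(3 * π / 4 * δ ^ 2 * (r ^ 2 + u ^ 2))) ≤
      3 * δ ^ β * ((1 + |r|) ^ β + (1 + |u|) ^ β) := by
    refine (one_sub_exp_neg_le_rpow (p := β / 2) (by positivity) (by linarith) (by linarith)).trans ?_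
    have hsq : ∀ a : ℝ, 0 ≤ a → (a ^ 2) ^ (β / 2) = a ^ β := by
      intro a ha
      rw [← rpow_natCast, ← rpow_mul ha]; congr 1; push_cast; ring
    rw [mul_rpow (by positivity) (by positivity), mul_rpow (by positivity) (by positivity),
      hsq δ hδ.le]
    have h3 : (3 * π / 4) ^ (β / 2) ≤ 3 := by
      calc (3 * π / 4) ^ (β / 2) ≤ (3 : ℝ) ^ (β / 2) := by
            apply rpow_le_rpow (by positivity) _ (by positivity)
            have := pi_le_four; linarith
        _ ≤ 3 ^ (1 : ℝ) := rpow_le_rpow_of_exponent_le (by norm_num) (by linarith)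
        _ = 3 := by simp
    have h4 : (r ^ 2 + u ^ 2) ^ (β / 2) ≤ (1 + |r|) ^ β + (1 + |u|) ^ β := by
      refine (Real.rpow_add_le_add_rpow (by positivity) (by positivity) (by linarith)
        (by linarith)).trans ?_
      rw [← sq_abs r, ← sq_abs u, hsq _ (abs_nonneg _), hsq _ (abs_nonneg _)]
      gcongr <;> linarith
    gcongr
  rw [e1]
  calc _ ≤ exp (-π * δ ^ 2 / 8 * (r + u) ^ 2) * (3 * δ ^ β * ((1 + |r|) ^ β + (1 + |u|) ^ β)) := by
        apply mul_le_mul e2 e3 _ (exp_pos _).le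
        rw [sub_nonneg, exp_le_one_iff, neg_nonpos]
        positivity
    _ = _ := by ring

lemma rpow_neg_mul_rpow_neg_le {x y a b : ℝ} (hx : 1 ≤ x) (hy : 1 ≤ y) (ha : 0 ≤ a) (hb : 0 ≤ b) :
    x ^ (-a) * y ^ (-b) ≤ x ^ (-(a + b)) + y ^ (-(a + b)) := by
  have hx0 : 0 < x := by linarith
  have hy0 : 0 < y := by linarith
  rw [neg_add, rpow_add hx0, rpow_add hy0]
  rcases le_total x y with h | h
  · have : x ^ (-a) * y ^ (-b) ≤ x ^ (-a) * x ^ (-b) := by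
      gcongr 1
      exact rpow_le_rpow_of_nonpos hx0 h (by linarith)
    have : 0 ≤ y ^ (-a) * y ^ (-b) := by positivity
    linarith
  · have : x ^ (-a) * y ^ (-b) ≤ y ^ (-a) * y ^ (-b) := by
      gcongr 1
      exact rpow_le_rpow_of_nonpos hy0 h (by linarith)
    have : 0 ≤ x ^ (-a) * x ^ (-b) := by positivity
    linarith

/-- Since `β ≤ s / 2`, the growth is absorbed with both exponents still nonpositive. The mixed
product is then at most its value with both bases equal to the smaller one, which decouples the
variables. -/
lemma rpow_add_rpow_mul_le {x y β s : ℝ} (hx : 1 ≤ x) (hy : 1 ≤ y) (hs : 0 ≤ s) (hβ : β ≤ s / 2) :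
    (x ^ β + y ^ β) * (x ^ (-s / 2) * y ^ (-s / 2)) ≤ 2 * (x ^ (-(s - β)) + y ^ (-(s - β))) := by
  have hx0 : 0 < x := by linarith
  have hy0 : 0 < y := by linarith
  have h1 := rpow_neg_mul_rpow_neg_le hx hy (a := s / 2 - β) (b := s / 2) (by linarith) (by linarith)
  have h2 := rpow_neg_mul_rpow_neg_le hy hx (a := s / 2 - β) (b := s / 2) (by linarith) (by linarith)
  have e : s / 2 - β + s / 2 = s - β := by ring
  rw [e] at h1 h2
  have e1 : ∀ z : ℝ, 0 < z → z ^ β * z ^ (-s / 2) = z ^ (-(s / 2 - β)) := by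
    intro z hz
    rw [← rpow_add hz]; congr 1; ring
  calc (x ^ β + y ^ β) * (x ^ (-s / 2) * y ^ (-s / 2))
      = (x ^ β * x ^ (-s / 2)) * y ^ (-s / 2) + (y ^ β * y ^ (-s / 2)) * x ^ (-s / 2) := by ring
    _ ≤ _ := by
      rw [e1 x hx0, e1 y hy0, neg_div]
      linarith

section
variable {μ : Measure Plane} [IsFiniteMeasure μ]

/-- Polynomial Fourier decay is preserved by the projections, including at low frequencies. -/
lemma norm_projFourier_le_of_decay {s : ℝ} (hs : 0 ≤ s)
    (hμ : ∀ ξ : Plane, ξ ≠ 0 → ‖measureFourier μ ξ‖ ≤ ‖ξ‖ ^ (-s / 2)) (θ w : ℝ) :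
    ‖projFourier μ θ w‖ ≤ (μ.real univ + 1) * 2 ^ (s / 2) * (1 + |w|) ^ (-s / 2) := by
  have hM : 0 ≤ μ.real univ := measureReal_nonneg
  rcases le_total |w| 1 with h | h
  · refine (norm_projFourier_le θ w).trans ?_
    have h1 : 1 ≤ (2 : ℝ) ^ (s / 2) * (1 + |w|) ^ (-s / 2) := by
      have : (2 : ℝ) ^ (-s / 2) ≤ (1 + |w|) ^ (-s / 2) :=
        rpow_le_rpow_of_nonpos (by positivity) (by linarith) (by linarith)
      calc (1 : ℝ) = 2 ^ (s / 2) * 2 ^ (-s / 2) := by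
            rw [← rpow_add (by norm_num), neg_div]; simp
        _ ≤ _ := by gcongr
    rw [mul_assoc]
    nlinarith
  · have hw : w ≠ 0 := by rintro rfl; norm_num at h
    have hn : ‖w • dirVec θ‖ = |w| := by rw [norm_smul, norm_dirVec]; simp
    have h0 : w • dirVec θ ≠ 0 := by
      rw [← norm_ne_zero_iff, hn]; positivity
    refine (hμ _ h0).trans ?_
    rw [hn]
    have h1 : |w| ^ (-s / 2) ≤ 2 ^ (s / 2) * (1 + |w|) ^ (-s / 2) := by
      have : (2 * |w|) ^ (-s / 2) ≤ (1 + |w|) ^ (-s / 2) :=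
        rpow_le_rpow_of_nonpos (by positivity) (by linarith) (by linarith)
      calc |w| ^ (-s / 2) = 2 ^ (s / 2) * (2 * |w|) ^ (-s / 2) := by
            rw [mul_rpow (by norm_num) (by positivity), ← mul_assoc, ← rpow_add (by norm_num),
              neg_div]
            simp
        _ ≤ _ := by gcongr
    have : 0 ≤ (2 : ℝ) ^ (s / 2) * (1 + |w|) ^ (-s / 2) := by positivity
    rw [mul_assoc]
    nlinarith

end

lemma norm_gaussFourier_mul_sub_le {μ : Measure Plane} {s β C δ θ : ℝ} (hs : 0 ≤ s)
    (hβ : 0 ≤ β) (hβ2 : β ≤ 2) (hβs : β ≤ s / 2) (hδ : 0 < δ)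
    (hC : ∀ w, ‖projFourier μ θ w‖ ≤ C * (1 + |w|) ^ (-s / 2)) (r u : ℝ) :
    ‖gaussFourier μ (δ / 2) θ r * gaussFourier μ (δ / 2) θ u -
        gaussFourier μ δ θ r * gaussFourier μ δ θ u‖ ≤
      6 * C ^ 2 * δ ^ β * exp (-π * δ ^ 2 / 8 * (r + u) ^ 2) *
        ((1 + |r|) ^ (-(s - β)) + (1 + |u|) ^ (-(s - β))) := by
  have hx : 1 ≤ 1 + |r| := by linarith [abs_nonneg r]
  have hy : 1 ≤ 1 + |u| := by linarith [abs_nonneg u]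
  have e : gaussFourier μ (δ / 2) θ r * gaussFourier μ (δ / 2) θ u -
        gaussFourier μ δ θ r * gaussFourier μ δ θ u =
      ((exp (-π * (δ / 2) ^ 2 * r ^ 2) * exp (-π * (δ / 2) ^ 2 * u ^ 2) -
      exp (-π * δ ^ 2 * r ^ 2) * exp (-π * δ ^ 2 * u ^ 2) : ℝ) : ℂ) *
        (projFourier μ θ r * projFourier μ θ u) := by
    simp only [gaussFourier]
    push_cast
    ring
  have hpos : 0 ≤ exp (-π * (δ / 2) ^ 2 * r ^ 2) * exp (-π * (δ / 2) ^ 2 * u ^ 2) -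
      exp (-π * δ ^ 2 * r ^ 2) * exp (-π * δ ^ 2 * u ^ 2) := by
    rw [sub_nonneg]
    have hle : ∀ v : ℝ, -π * δ ^ 2 * v ^ 2 ≤ -π * (δ / 2) ^ 2 * v ^ 2 := by
      intro v
      have : 0 ≤ π * δ ^ 2 * v ^ 2 := by positivity
      linarith
    exact mul_le_mul (exp_le_exp.2 (hle r)) (exp_le_exp.2 (hle u)) (exp_pos _).le (exp_pos _).le
  rw [e, norm_mul, norm_mul, Complex.norm_real, Real.norm_of_nonneg hpos]
  calc _ ≤ (3 * δ ^ β * exp (-π * δ ^ 2 / 8 * (r + u) ^ 2) * ((1 + |r|) ^ β + (1 + |u|) ^ β)) *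
        ((C * (1 + |r|) ^ (-s / 2)) * (C * (1 + |u|) ^ (-s / 2))) := by
        gcongr
        · exact gauss_sub_gauss_le hδ hβ hβ2
        · exact (norm_nonneg _).trans (hC r)
        · exact hC r
        · exact hC u
    _ = (3 * C ^ 2 * δ ^ β * exp (-π * δ ^ 2 / 8 * (r + u) ^ 2)) *
        (((1 + |r|) ^ β + (1 + |u|) ^ β) * ((1 + |r|) ^ (-s / 2) * (1 + |u|) ^ (-s / 2))) := by
        ring
    _ ≤ (3 * C ^ 2 * δ ^ β * exp (-π * δ ^ 2 / 8 * (r + u) ^ 2)) *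
        (2 * ((1 + |r|) ^ (-(s - β)) + (1 + |u|) ^ (-(s - β)))) := by
        exact mul_le_mul_of_nonneg_left (rpow_add_rpow_mul_le hx hy hs hβs) (by positivity)
    _ = _ := by ring

/-- Translation invariance: with one variable frozen, `f` of the sum integrates to the full integral
of `f`. The two summands contribute equally. -/
lemma lintegral_prod_comp_add_mul {f g : ℝ → ℝ≥0∞} (hf : Measurable f) (hg : Measurable g) :
    ∫⁻ z : ℝ × ℝ, f (z.1 + z.2) * (g z.1 + g z.2) = 2 * (∫⁻ r, g r) * ∫⁻ w, f w := by
  have h1 : ∫⁻ z : ℝ × ℝ, f (z.1 + z.2) * g z.1 = (∫⁻ r, g r) * ∫⁻ w, f w := by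
    rw [Measure.volume_eq_prod, lintegral_prod _ (by fun_prop)]
    have : ∀ r : ℝ, ∫⁻ u, f (r + u) * g r = g r * ∫⁻ w, f w := by
      intro r
      rw [lintegral_mul_const _ (by fun_prop), lintegral_add_left_eq_self (μ := volume) f r,
        mul_comm]
    simp_rw [this]
    rw [lintegral_mul_const _ hg]
  have h2 : ∫⁻ z : ℝ × ℝ, f (z.1 + z.2) * g z.2 = (∫⁻ r, g r) * ∫⁻ w, f w := by
    rw [← h1, Measure.volume_eq_prod, ← lintegral_prod_swap]
    simp only [Prod.fst_swap, Prod.snd_swap, add_comm]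
  simp_rw [mul_add]
  rw [lintegral_add_left (by fun_prop), h1, h2]
  ring

section
variable {μ : Measure Plane} [IsFiniteMeasure μ]

lemma enorm_sum_gaussProj_sq_sub_le_of_decay {ι : Type*} (T : Finset ι) (x : ι → Plane)
    {s β C δ θ : ℝ} (hs : 0 ≤ s) (hβ : 0 ≤ β) (hβ2 : β ≤ 2) (hβs : β ≤ s / 2) (hδ : 0 < δ)
    (hC : ∀ w, ‖projFourier μ θ w‖ ≤ C * (1 + |w|) ^ (-s / 2)) :
    ‖∑ i ∈ T, (gaussProj μ (δ / 2) θ (x i) ^ 2 - gaussProj μ δ θ (x i) ^ 2)‖ₑ ≤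
      2 * (∫⁻ r : ℝ, ENNReal.ofReal ((1 + |r|) ^ (-(s - β)))) *
        ∫⁻ w, ENNReal.ofReal (6 * C ^ 2 * δ ^ β * exp (-π * δ ^ 2 / 8 * w ^ 2) *
          ‖expSum T (fun i => dirCoord θ (x i)) w‖) := by
  have hm : Measurable fun w : ℝ => (6 * C ^ 2 * δ ^ β * exp (-π * δ ^ 2 / 8 * w ^ 2) *
          ‖expSum T (fun i => dirCoord θ (x i)) w‖) := by
    unfold expSum
    fun_prop
  refine (enorm_sum_gaussProj_sq_sub_le T x hδ (half_pos hδ) θ).trans ?_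
  rw [← lintegral_prod_comp_add_mul (by fun_prop) (by fun_prop)]
  refine lintegral_mono fun z => ?_
  rw [← ENNReal.ofReal_add (by positivity) (by positivity), ← ENNReal.ofReal_mul (by positivity),
    ← ofReal_norm, norm_mul]
  refine ENNReal.ofReal_le_ofReal ?_
  calc _ ≤ (6 * C ^ 2 * δ ^ β * exp (-π * δ ^ 2 / 8 * (z.1 + z.2) ^ 2) *
        ((1 + |z.1|) ^ (-(s - β)) + (1 + |z.2|) ^ (-(s - β)))) *
          ‖expSum T (fun i => dirCoord θ (x i)) (z.1 + z.2)‖ := by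
        gcongr
        exact norm_gaussFourier_mul_sub_le hs hβ hβ2 hβs hδ hC z.1 z.2
    _ = _ := by ring

end

/-! ### Exponential sums: from `L¹` on lines to `L²` in the plane -/

lemma norm_expSum_neg {ι : Type*} (T : Finset ι) (t : ι → ℝ) (w : ℝ) :
    ‖expSum T t (-w)‖ = ‖expSum T t w‖ := by
  have : expSum T t (-w) = starRingEnd ℂ (expSum T t w) := by
    simp only [expSum, map_sum, ← Complex.exp_conj, map_mul, Complex.conj_I, Complex.conj_ofReal]
    refine Finset.sum_congr rfl fun i _ => ?_
    congr 1
    push_cast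
    ring
  rw [this, RCLike.norm_conj]

@[fun_prop] lemma continuous_expSum {ι : Type*} (T : Finset ι) (t : ι → ℝ) :
    Continuous (expSum T t) := by
  unfold expSum; fun_prop

lemma exp_neg_le_rpow {a p : ℝ} (ha : 0 < a) (hp : 0 ≤ p) (hp1 : p ≤ 1) : exp (-a) ≤ a ^ (-p) := by
  have h1 : a ^ p ≤ exp a := by
    rcases le_total a 1 with h | h
    · exact (rpow_le_one ha.le h hp).trans (one_le_exp ha.le)
    · calc a ^ p ≤ a ^ (1 : ℝ) := rpow_le_rpow_of_exponent_le h hp1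
        _ = a := rpow_one a
        _ ≤ exp a := by linarith [add_one_le_exp a]
  rw [exp_neg, rpow_neg ha.le]
  exact inv_anti₀ (rpow_pos_of_pos ha p) h1

/-- AM–GM with weight `κ |w|`, chosen because `|w|` is the polar Jacobian. The leftover `1/|w|`
would diverge logarithmically; the Gaussian supplies `|w|^(-ε)` at the cost of `δ^(-ε)`. -/
lemma gauss_mul_le_of_one_lt {δ ε κ a w : ℝ} (hδ : 0 < δ) (hε : 0 ≤ ε) (hε2 : ε ≤ 2) (hκ : 0 < κ)
    (hw : 1 < |w|) :
    exp (-π * δ ^ 2 / 8 * w ^ 2) * a ≤ 64 * κ⁻¹ * δ ^ (-ε) * (1 + |w|) ^ (-(1 + ε)) +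
      κ * (|w| * (exp (-π * δ ^ 2 / 8 * w ^ 2) * a ^ 2)) := by
  have hw0 : 0 < |w| := by linarith
  have h1 : a ≤ κ⁻¹ * |w|⁻¹ + κ * |w| * a ^ 2 := by
    have h : 0 ≤ κ⁻¹ * |w|⁻¹ * (κ * |w| * a - 1 / 2) ^ 2 := by positivity
    have e : κ⁻¹ * |w|⁻¹ * (κ * |w| * a - 1 / 2) ^ 2 =
        κ * |w| * a ^ 2 - a + κ⁻¹ * |w|⁻¹ / 4 := by
      field_simp
      ring
    have : 0 ≤ κ⁻¹ * |w|⁻¹ := by positivity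
    linarith
  have h2 : exp (-π * δ ^ 2 / 8 * w ^ 2) ≤ 8 * (δ ^ (-ε) * |w| ^ (-ε)) := by
    have h := exp_neg_le_rpow (a := π / 8 * δ ^ 2 * |w| ^ 2) (p := ε / 2) (by positivity)
      (by linarith) (by linarith)
    have hsq : ∀ b : ℝ, 0 ≤ b → (b ^ 2) ^ (-(ε / 2)) = b ^ (-ε) := by
      intro b hb
      rw [← rpow_natCast, ← rpow_mul hb]; congr 1; push_cast; ring
    rw [mul_rpow (by positivity) (by positivity), mul_rpow (by positivity) (by positivity),
      hsq δ hδ.le, hsq _ hw0.le, sq_abs] at h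
    have h3 : (π / 8) ^ (-(ε / 2)) ≤ 8 := by
      calc (π / 8) ^ (-(ε / 2)) ≤ (8⁻¹ : ℝ) ^ (-(ε / 2)) := by
            apply rpow_le_rpow_of_nonpos (by positivity) _ (by linarith)
            have := pi_gt_three; linarith
        _ = (8 : ℝ) ^ (ε / 2) := by rw [inv_rpow (by norm_num), rpow_neg (by norm_num), inv_inv]
        _ ≤ 8 ^ (1 : ℝ) := rpow_le_rpow_of_exponent_le (by norm_num) (by linarith)
        _ = 8 := by simp
    calc exp (-π * δ ^ 2 / 8 * w ^ 2) = exp (-(π / 8 * δ ^ 2 * w ^ 2)) := by ring_nf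
      _ ≤ _ := h
      _ ≤ 8 * δ ^ (-ε) * |w| ^ (-ε) := by gcongr
      _ = _ := by ring
  have h3 : |w|⁻¹ * |w| ^ (-ε) ≤ 8 * (1 + |w|) ^ (-(1 + ε)) := by
    have h4 : (2 * |w|) ^ (-(1 + ε)) ≤ (1 + |w|) ^ (-(1 + ε)) :=
      rpow_le_rpow_of_nonpos (by positivity) (by linarith) (by linarith)
    have h5 : (1 : ℝ) / 8 ≤ 2 ^ (-(1 + ε)) := by
      calc (1 : ℝ) / 8 = 2 ^ (-3 : ℝ) := by
            rw [rpow_neg (by norm_num)]; norm_num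
        _ ≤ _ := rpow_le_rpow_of_exponent_le (by norm_num) (by linarith)
    rw [mul_rpow (by norm_num) hw0.le] at h4
    have h6 : |w|⁻¹ * |w| ^ (-ε) = |w| ^ (-(1 + ε)) := by
      rw [← rpow_neg_one, ← rpow_add hw0]; congr 1; ring
    rw [h6]
    have : 0 ≤ |w| ^ (-(1 + ε)) := by positivity
    nlinarith
  calc exp (-π * δ ^ 2 / 8 * w ^ 2) * a
      ≤ exp (-π * δ ^ 2 / 8 * w ^ 2) * (κ⁻¹ * |w|⁻¹ + κ * |w| * a ^ 2) := by gcongr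
    _ = exp (-π * δ ^ 2 / 8 * w ^ 2) * (κ⁻¹ * |w|⁻¹) +
      κ * (|w| * (exp (-π * δ ^ 2 / 8 * w ^ 2) * a ^ 2)) := by ring
    _ ≤ (8 * (δ ^ (-ε) * |w| ^ (-ε))) * (κ⁻¹ * |w|⁻¹) +
      κ * (|w| * (exp (-π * δ ^ 2 / 8 * w ^ 2) * a ^ 2)) := by gcongr
    _ = 8 * κ⁻¹ * δ ^ (-ε) * (|w|⁻¹ * |w| ^ (-ε)) +
      κ * (|w| * (exp (-π * δ ^ 2 / 8 * w ^ 2) * a ^ 2)) := by ring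
    _ ≤ 8 * κ⁻¹ * δ ^ (-ε) * (8 * (1 + |w|) ^ (-(1 + ε))) +
      κ * (|w| * (exp (-π * δ ^ 2 / 8 * w ^ 2) * a ^ 2)) := by gcongr
    _ = _ := by ring

lemma lintegral_gauss_mul_expSum_le {ι : Type*} (T : Finset ι) (t : ι → ℝ) {δ ε κ : ℝ}
    (hδ : 0 < δ) (hε : 0 ≤ ε) (hε2 : ε ≤ 2) (hκ : 0 < κ) :
    ∫⁻ w, ENNReal.ofReal (exp (-π * δ ^ 2 / 8 * w ^ 2) * ‖expSum T t w‖) ≤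
      2 * T.card + ENNReal.ofReal (64 * κ⁻¹ * δ ^ (-ε)) *
          (∫⁻ w : ℝ, ENNReal.ofReal ((1 + |w|) ^ (-(1 + ε)))) +
        ENNReal.ofReal κ * ∫⁻ w, ENNReal.ofReal (|w| * (exp (-π * δ ^ 2 / 8 * w ^ 2) *
          ‖expSum T t w‖ ^ 2)) := by
  have h : ∀ w : ℝ, ENNReal.ofReal (exp (-π * δ ^ 2 / 8 * w ^ 2) * ‖expSum T t w‖) ≤
      (Icc (-1 : ℝ) 1).indicator (fun _ => (T.card : ℝ≥0∞)) w +
      ENNReal.ofReal (64 * κ⁻¹ * δ ^ (-ε)) * ENNReal.ofReal ((1 + |w|) ^ (-(1 + ε))) +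
      ENNReal.ofReal κ * ENNReal.ofReal (|w| * (exp (-π * δ ^ 2 / 8 * w ^ 2) *
          ‖expSum T t w‖ ^ 2)) := by
    intro w
    rcases le_or_gt |w| 1 with hw | hw
    · rw [add_assoc]
      refine le_trans ?_ le_self_add
      rw [indicator_of_mem (s := Icc (-1 : ℝ) 1) (abs_le.1 hw), ← ENNReal.ofReal_natCast]
      refine ENNReal.ofReal_le_ofReal ?_
      refine (mul_le_of_le_one_left (norm_nonneg _) (exp_le_one_iff.2 ?_)).trans
        (norm_expSum_le T t w)
      have : 0 ≤ π * δ ^ 2 / 8 * w ^ 2 := by positivity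
      linarith
    · rw [add_assoc]
      refine le_trans ?_ le_add_self
      rw [← ENNReal.ofReal_mul (by positivity), ← ENNReal.ofReal_mul (by positivity),
        ← ENNReal.ofReal_add (by positivity) (by positivity)]
      exact ENNReal.ofReal_le_ofReal (gauss_mul_le_of_one_lt hδ hε hε2 hκ hw)
  refine (lintegral_mono h).trans (le_of_eq ?_)
  rw [lintegral_add_right _ (by fun_prop), lintegral_add_right _ (by fun_prop),
    lintegral_const_mul _ (by fun_prop), lintegral_const_mul _ (by fun_prop),
    lintegral_indicator_const measurableSet_Icc, Real.volume_Icc]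
  norm_num
  rw [mul_comm]

lemma lintegral_eq_two_mul_of_even {f : ℝ → ℝ≥0∞} (hf : ∀ w, f (-w) = f w) :
    ∫⁻ w, f w = 2 * ∫⁻ w in Ioi 0, f w := by
  have h1 : ∫⁻ w in Iio (0 : ℝ), f w = ∫⁻ w in Ioi 0, f w := by
    have h := (Measure.measurePreserving_neg (volume : Measure ℝ)).setLIntegral_comp_preimage_emb
      (MeasurableEquiv.neg ℝ).measurableEmbedding f (Ioi 0)
    rw [← h]
    simp [hf]
  rw [← lintegral_add_compl f (measurableSet_Ioi (a := (0 : ℝ))), compl_Ioi,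
    setLIntegral_congr Iio_ae_eq_Iic.symm, h1, two_mul]

/-- The planar exponential sum with frequencies `x i`, `i ∈ T`. -/
def planeExpSum {ι : Type*} (T : Finset ι) (x : ι → Plane) (p : ℝ × ℝ) : ℂ :=
  ∑ i ∈ T, Complex.exp ((2 * π * (p.1 * x i 0 + p.2 * x i 1) : ℝ) * Complex.I)

/-- Polar coordinates: `|w|` is the Jacobian, and the factor 2 appears because `w` runs over both
half-lines. -/
lemma lintegral_abs_mul_eq_planar {ι : Type*} (T : Finset ι) (x : ι → Plane) (c : ℝ) :
    ∫⁻ θ in Ioo (-π) π, ∫⁻ w, ENNReal.ofReal (|w| * (exp (c * w ^ 2) *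
        ‖expSum T (fun i => dirCoord θ (x i)) w‖ ^ 2)) =
      2 * ∫⁻ p : ℝ × ℝ, ENNReal.ofReal (exp (c * (p.1 ^ 2 + p.2 ^ 2)) *
        ‖planeExpSum T x p‖ ^ 2) := by
  have h1 : ∀ θ : ℝ, ∫⁻ w, ENNReal.ofReal (|w| * (exp (c * w ^ 2) *
        ‖expSum T (fun i => dirCoord θ (x i)) w‖ ^ 2)) =
      2 * ∫⁻ w in Ioi (0 : ℝ), ENNReal.ofReal (|w| * (exp (c * w ^ 2) *
        ‖expSum T (fun i => dirCoord θ (x i)) w‖ ^ 2)) := by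
    intro θ
    refine lintegral_eq_two_mul_of_even fun w => ?_
    rw [norm_expSum_neg, abs_neg, neg_sq]
  have hcont : Continuous fun z : ℝ × ℝ => |z.1| * (exp (c * z.1 ^ 2) *
        ‖expSum T (fun i => dirCoord z.2 (x i)) z.1‖ ^ 2) := by
    unfold expSum; fun_prop
  simp_rw [h1]
  rw [lintegral_const_mul', ← lintegral_comp_polarCoord_symm]
  · congr 1
    rw [polarCoord_target, Measure.volume_eq_prod, ← Measure.prod_restrict,
      lintegral_prod_symm' _ ?_]
    · refine lintegral_congr fun θ => setLIntegral_congr_fun measurableSet_Ioi fun w hw => ?_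
      have hw' : (0 : ℝ) < w := hw
      have e1 : planeExpSum T x (polarCoord.symm (w, θ)) =
          expSum T (fun i => dirCoord θ (x i)) w := by
        simp only [planeExpSum, expSum, polarCoord_symm_apply, dirCoord]
        refine Finset.sum_congr rfl fun i _ => ?_
        congr 3
        ring
      have e2 : (polarCoord.symm (w, θ)).1 ^ 2 + (polarCoord.symm (w, θ)).2 ^ 2 = w ^ 2 := by
        simp only [polarCoord_symm_apply]
        linear_combination w ^ 2 * sin_sq_add_cos_sq θ
      simp only [e1, e2, smul_eq_mul, abs_of_pos hw']
      rw [ENNReal.ofReal_mul hw'.le]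
    · have : Measurable fun z : ℝ × ℝ => polarCoord.symm z := by
        simp only [polarCoord_symm_apply]
        fun_prop
      have h2 : Measurable fun p : ℝ × ℝ => ENNReal.ofReal (exp (c * (p.1 ^ 2 + p.2 ^ 2)) *
        ‖planeExpSum T x p‖ ^ 2) := by
        unfold planeExpSum; fun_prop
      exact (by fun_prop : Measurable fun z : ℝ × ℝ => ENNReal.ofReal z.1).smul (h2.comp this)
  · norm_num

/-- Expanding the square gives one planar Gaussian transform per pair of points, hence a kernel
concentrated on pairs at distance at most of order `η`. -/
lemma lintegral_gauss_mul_planeExpSum_sq {ι : Type*} (T : Finset ι) (x : ι → Plane) {η : ℝ}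
    (hη : 0 < η) :
    ∫⁻ p : ℝ × ℝ, ENNReal.ofReal (exp (-π * η ^ 2 * (p.1 ^ 2 + p.2 ^ 2)) *
        ‖planeExpSum T x p‖ ^ 2) =
      ENNReal.ofReal (∑ i ∈ T, ∑ k ∈ T, (η⁻¹ * exp (-π * (x i 0 - x k 0) ^ 2 / η ^ 2)) *
        (η⁻¹ * exp (-π * (x i 1 - x k 1) ^ 2 / η ^ 2))) := by
  set g : ℝ → ℝ → ℂ := fun v w =>
    Complex.exp ((2 * π * (w * v) : ℝ) * Complex.I) * (exp (-π * η ^ 2 * w ^ 2) : ℝ) with hg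
  have hgi : ∀ v, Integrable (g v) := by
    intro v
    refine Integrable.mono' (integrable_gauss hη)
      (Continuous.aestronglyMeasurable (by fun_prop)) (.of_forall fun w => ?_)
    rw [hg, norm_mul, norm_exp_mul_I_one, one_mul, Complex.norm_real,
        Real.norm_of_nonneg (exp_pos _).le]
  have hint : ∀ i k, Integrable (fun p : ℝ × ℝ =>
      g (x i 0 - x k 0) p.1 * g (x i 1 - x k 1) p.2) :=
    fun i k => (hgi _).mul_prod (hgi _)
  have key : ∀ p : ℝ × ℝ, ((exp (-π * η ^ 2 * (p.1 ^ 2 + p.2 ^ 2)) *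
        ‖planeExpSum T x p‖ ^ 2 : ℝ) : ℂ) =
      ∑ i ∈ T, ∑ k ∈ T, g (x i 0 - x k 0) p.1 * g (x i 1 - x k 1) p.2 := by
    intro p
    rw [Complex.ofReal_mul, Complex.ofReal_pow, ← Complex.mul_conj']
    conv_lhs => rw [planeExpSum, map_sum, Finset.sum_mul_sum]
    rw [Finset.mul_sum]
    refine Finset.sum_congr rfl fun i _ => ?_
    rw [Finset.mul_sum]
    refine Finset.sum_congr rfl fun k _ => ?_
    simp only [hg, ← Complex.exp_conj, map_mul, Complex.conj_I, Complex.conj_ofReal,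
      Complex.ofReal_exp, ← Complex.exp_add]
    congr 1
    push_cast
    ring
  have hreal : Integrable fun p : ℝ × ℝ => exp (-π * η ^ 2 * (p.1 ^ 2 + p.2 ^ 2)) *
        ‖planeExpSum T x p‖ ^ 2 := by
    have h : Integrable fun p : ℝ × ℝ => ((exp (-π * η ^ 2 * (p.1 ^ 2 + p.2 ^ 2)) *
        ‖planeExpSum T x p‖ ^ 2 : ℝ) : ℂ) := by
      simp_rw [key]
      exact integrable_finsetSum _ fun i _ => integrable_finsetSum _ fun k _ => hint i k
    exact_mod_cast h.re
  rw [← ofReal_integral_eq_lintegral_ofReal hreal (.of_forall fun p => by positivity)]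
  congr 1
  rw [← Complex.ofReal_inj, ← integral_complex_ofReal]
  simp_rw [key]
  rw [integral_finsetSum _ fun i _ => integrable_finsetSum _ fun k _ => hint i k,
    Complex.ofReal_sum]
  refine Finset.sum_congr rfl fun i _ => ?_
  rw [integral_finsetSum _ fun k _ => hint i k, Complex.ofReal_sum]
  refine Finset.sum_congr rfl fun k _ => ?_
  rw [Measure.volume_eq_prod, integral_prod_mul, Complex.ofReal_mul]
  congr 1 <;> exact integral_gauss_mul_exp hη _

/-! ### Almost orthogonality for one point per grid cell -/

/-- The half-open grid cell of side `δ` containing `y`, given by its integer coordinates. -/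
def gridCell (δ : ℝ) (y : Plane) : ℤ × ℤ := (⌊y 0 / δ⌋, ⌊y 1 / δ⌋)

/-- The majorant of a Gaussian row sum over a unit grid. -/
def latticeSum : ℝ := ∑' n : ℤ, exp (2 - |(n : ℝ)|)

lemma summable_exp_two_sub_abs : Summable fun n : ℤ => exp (2 - |(n : ℝ)|) := by
  have h : Summable fun n : ℕ => exp (2 - (n : ℝ)) := by
    have := Real.summable_exp_neg_nat.mul_left (exp 2)
    simpa only [← exp_add, ← sub_eq_add_neg] using this
  apply Summable.of_nat_of_neg <;> simpa using h

lemma sum_exp_two_sub_abs_le (S : Finset ℤ) (c : ℤ) :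
    ∑ a ∈ S, exp (2 - |((c - a : ℤ) : ℝ)|) ≤ latticeSum := by
  have h : Summable fun a : ℤ => exp (2 - |((c - a : ℤ) : ℝ)|) :=
    (Equiv.subLeft c).summable_iff.2 summable_exp_two_sub_abs
  refine (h.sum_le_tsum S fun a _ => (exp_pos _).le).trans (le_of_eq ?_)
  exact (Equiv.subLeft c).tsum_eq fun n : ℤ => exp (2 - |(n : ℝ)|)

/-- With `t = (a - b) / δ` the exponent is `-8πt²`, and `8πt² ≥ t² ≥ |t| - 1`; taking floors loses
one more, whence the 2. The scale `δ / √8` matches the Gaussian `exp (-π δ² w² / 8)` of the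
increment kernel. -/
lemma gauss_le_exp_two_sub_abs_floor {δ a b : ℝ} (hδ : 0 < δ) :
    exp (-π * (a - b) ^ 2 / (δ / √8) ^ 2) ≤ exp (2 - |((⌊a / δ⌋ - ⌊b / δ⌋ : ℤ) : ℝ)|) := by
  apply exp_le_exp.2
  have e : -π * (a - b) ^ 2 / (δ / √8) ^ 2 = -(8 * π * (a / δ - b / δ) ^ 2) := by
    rw [div_pow, sq_sqrt (by norm_num)]
    field_simp
  rw [e]
  have ha := Int.floor_le (a / δ)
  have ha' := Int.lt_floor_add_one (a / δ)
  have hb := Int.floor_le (b / δ)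
  have hb' := Int.lt_floor_add_one (b / δ)
  set t := a / δ - b / δ with ht
  have h1 : |((⌊a / δ⌋ - ⌊b / δ⌋ : ℤ) : ℝ)| ≤ |t| + 1 := by
    push_cast
    rw [abs_le]
    have := neg_abs_le t
    have := le_abs_self t
    constructor <;> linarith
  have h2 : |t| ≤ t ^ 2 + 1 := by nlinarith [sq_abs t, sq_nonneg (|t| - 1), abs_nonneg t]
  have h3 : t ^ 2 ≤ 8 * π * t ^ 2 := by nlinarith [pi_gt_three, sq_nonneg t]
  linarith

/-- Schur-type row bound: since distinct points lie in distinct cells, each row is dominated by a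
product of two lattice sums, independent of the number of points. -/
lemma sum_gauss_grid_le {T : Finset (ℤ × ℤ)} {x : ℤ × ℤ → Plane} {δ : ℝ} (hδ : 0 < δ)
    (hx : ∀ c ∈ T, gridCell δ (x c) = c) :
    ∑ i ∈ T, ∑ k ∈ T, ((δ / √8)⁻¹ * exp (-π * (x i 0 - x k 0) ^ 2 / (δ / √8) ^ 2)) *
        ((δ / √8)⁻¹ * exp (-π * (x i 1 - x k 1) ^ 2 / (δ / √8) ^ 2)) ≤
      T.card * (8 * δ⁻¹ ^ 2 * latticeSum ^ 2) := by
  rw [← nsmul_eq_mul]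
  refine Finset.sum_le_card_nsmul _ _ _ fun i hi => ?_
  have hη : (δ / √8)⁻¹ ^ 2 = 8 * δ⁻¹ ^ 2 := by
    rw [inv_pow, div_pow, sq_sqrt (by norm_num)]
    field_simp
  have h0 : ∀ k ∈ T, ((δ / √8)⁻¹ * exp (-π * (x i 0 - x k 0) ^ 2 / (δ / √8) ^ 2)) *
        ((δ / √8)⁻¹ * exp (-π * (x i 1 - x k 1) ^ 2 / (δ / √8) ^ 2)) ≤
      8 * δ⁻¹ ^ 2 * (exp (2 - |((i.1 - k.1 : ℤ) : ℝ)|) * exp (2 - |((i.2 - k.2 : ℤ) : ℝ)|)) := by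
    intro k hk
    rw [mul_mul_mul_comm, ← sq, hη]
    have h1 := gauss_le_exp_two_sub_abs_floor (a := x i 0) (b := x k 0) hδ
    have h2 := gauss_le_exp_two_sub_abs_floor (a := x i 1) (b := x k 1) hδ
    have hi0 := congrArg Prod.fst (hx i hi)
    have hi1 := congrArg Prod.snd (hx i hi)
    have hk0 := congrArg Prod.fst (hx k hk)
    have hk1 := congrArg Prod.snd (hx k hk)
    simp only [gridCell] at hi0 hi1 hk0 hk1
    rw [hi0, hk0] at h1
    rw [hi1, hk1] at h2
    gcongr
  refine (Finset.sum_le_sum h0).trans ?_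
  rw [← Finset.mul_sum]
  refine mul_le_mul_of_nonneg_left ?_ (by positivity)
  calc ∑ k ∈ T, exp (2 - |((i.1 - k.1 : ℤ) : ℝ)|) * exp (2 - |((i.2 - k.2 : ℤ) : ℝ)|)
      ≤ ∑ k ∈ T.image Prod.fst ×ˢ T.image Prod.snd,
          exp (2 - |((i.1 - k.1 : ℤ) : ℝ)|) * exp (2 - |((i.2 - k.2 : ℤ) : ℝ)|) := by
        refine Finset.sum_le_sum_of_subset_of_nonneg Finset.subset_product
          fun _ _ _ => by positivity
    _ = (∑ a ∈ T.image Prod.fst, exp (2 - |((i.1 - a : ℤ) : ℝ)|)) *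
          ∑ b ∈ T.image Prod.snd, exp (2 - |((i.2 - b : ℤ) : ℝ)|) := by
        rw [Finset.sum_product, Finset.sum_mul_sum]
    _ ≤ latticeSum * latticeSum := by
        have h : 0 ≤ ∑ a ∈ T.image Prod.fst, exp (2 - |((i.1 - a : ℤ) : ℝ)|) :=
          Finset.sum_nonneg fun _ _ => (exp_pos _).le
        exact mul_le_mul (sum_exp_two_sub_abs_le _ _) (sum_exp_two_sub_abs_le _ _)
          (Finset.sum_nonneg fun _ _ => (exp_pos _).le)
          (h.trans (sum_exp_two_sub_abs_le (T.image Prod.fst) i.1))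
    _ = latticeSum ^ 2 := by ring

lemma lintegral_abs_mul_expSum_sq_le {T : Finset (ℤ × ℤ)} {x : ℤ × ℤ → Plane} {δ : ℝ} (hδ : 0 < δ)
    (hx : ∀ c ∈ T, gridCell δ (x c) = c) :
    ∫⁻ θ in Ioo (-π) π, ∫⁻ w, ENNReal.ofReal (|w| * (exp (-π * δ ^ 2 / 8 * w ^ 2) *
        ‖expSum T (fun i => dirCoord θ (x i)) w‖ ^ 2)) ≤
      ENNReal.ofReal (2 * (T.card * (8 * δ⁻¹ ^ 2 * latticeSum ^ 2))) := by
  have e : -π * δ ^ 2 / 8 = -π * (δ / √8) ^ 2 := by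
    rw [div_pow, sq_sqrt (by norm_num)]; ring
  rw [lintegral_abs_mul_eq_planar, e, lintegral_gauss_mul_planeExpSum_sq T x (by positivity),
    ENNReal.ofReal_mul (by norm_num)]
  norm_num only [ENNReal.ofReal_ofNat]
  gcongr
  exact sum_gauss_grid_le hδ hx

lemma lintegral_japanese {p : ℝ} (hp : 1 < p) :
    ∫⁻ w : ℝ, ENNReal.ofReal ((1 + |w|) ^ (-p)) = ENNReal.ofReal (∫ w : ℝ, (1 + |w|) ^ (-p)) := by
  have h : Integrable fun w : ℝ => (1 + |w|) ^ (-p) := by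
    have := integrable_one_add_norm (E := ℝ) (μ := volume) (r := p) (by simpa using hp)
    simpa using this
  exact (ofReal_integral_eq_lintegral_ofReal h (.of_forall fun w => by positivity)).symm

/-! ### Counting cells with a large energy increment -/

section
variable {μ : Measure Plane} [IsFiniteMeasure μ]

lemma sum_radialEnergy_sub_le {s β ε C : ℝ} (hs : 0 ≤ s) (hβ : 0 ≤ β) (hβs : β ≤ s / 2)
    (hε : 0 < ε) (hε2 : ε ≤ 2) (hsum : s - β = 1 + ε) (hβ2 : β ≤ 2)
    (hC : ∀ θ w, ‖projFourier μ θ w‖ ≤ C * (1 + |w|) ^ (-s / 2))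
    {δ κ : ℝ} (hδ : 0 < δ) (hκ : 0 < κ) {T : Finset (ℤ × ℤ)} {x : ℤ × ℤ → Plane}
    (hx : ∀ c ∈ T, gridCell δ (x c) = c) :
    ∑ c ∈ T, (radialEnergy μ (δ / 2) (x c) - radialEnergy μ δ (x c)) ≤
      2 * (∫ w : ℝ, (1 + |w|) ^ (-(1 + ε))) * (6 * C ^ 2 * δ ^ β) *
        (2 * π * (2 * T.card + 64 * κ⁻¹ * δ ^ (-ε) * ∫ w : ℝ, (1 + |w|) ^ (-(1 + ε))) +
          κ * (2 * (T.card * (8 * δ⁻¹ ^ 2 * latticeSum ^ 2)))) := by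
  set J : ℝ := ∫ w : ℝ, (1 + |w|) ^ (-(1 + ε)) with hJ
  have hJ0 : 0 ≤ J := integral_nonneg fun w => by positivity
  have hJl := lintegral_japanese (p := 1 + ε) (by linarith)
  rw [← hJ] at hJl
  have h1 : ∑ c ∈ T, (radialEnergy μ (δ / 2) (x c) - radialEnergy μ δ (x c)) =
      ∫ θ in Ioo (-π) π,
        ∑ c ∈ T, (gaussProj μ (δ / 2) θ (x c) ^ 2 - gaussProj μ δ θ (x c) ^ 2) := by
    rw [integral_finsetSum]
    · refine Finset.sum_congr rfl fun c _ => ?_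
      rw [integral_sub (integrableOn_gaussProj_sq (half_pos hδ) _) (integrableOn_gaussProj_sq hδ _)]
      rfl
    · exact fun c _ => (integrableOn_gaussProj_sq (half_pos hδ) _).sub
        (integrableOn_gaussProj_sq hδ _)
  rw [h1]
  refine (le_norm_self _).trans ?_
  rw [← ENNReal.ofReal_le_ofReal_iff (by positivity), ofReal_norm]
  refine (enorm_integral_le_lintegral_enorm _).trans ?_
  have h2 : ∀ θ : ℝ, ‖∑ c ∈ T, (gaussProj μ (δ / 2) θ (x c) ^ 2 - gaussProj μ δ θ (x c) ^ 2)‖ₑ ≤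
      ENNReal.ofReal (2 * J * (6 * C ^ 2 * δ ^ β)) *
        ((2 * T.card + ENNReal.ofReal (64 * κ⁻¹ * δ ^ (-ε)) * ENNReal.ofReal J) +
          ENNReal.ofReal κ * ∫⁻ w, ENNReal.ofReal (|w| * (exp (-π * δ ^ 2 / 8 * w ^ 2) *
          ‖expSum T (fun i => dirCoord θ (x i)) w‖ ^ 2))) := by
    intro θ
    refine (enorm_sum_gaussProj_sq_sub_le_of_decay T x hs hβ hβ2 hβs hδ (hC θ)).trans ?_
    have h3 : ∫⁻ w, ENNReal.ofReal (6 * C ^ 2 * δ ^ β * exp (-π * δ ^ 2 / 8 * w ^ 2) *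
          ‖expSum T (fun i => dirCoord θ (x i)) w‖) =
        ENNReal.ofReal (6 * C ^ 2 * δ ^ β) * ∫⁻ w, ENNReal.ofReal (exp (-π * δ ^ 2 / 8 * w ^ 2) *
          ‖expSum T (fun i => dirCoord θ (x i)) w‖) := by
      rw [← lintegral_const_mul _ (by fun_prop)]
      refine lintegral_congr fun w => ?_
      rw [← ENNReal.ofReal_mul (by positivity)]
      ring_nf
    rw [h3, hsum, hJl, ← mul_assoc, ENNReal.ofReal_mul (p := 2 * J) (by positivity),
      ENNReal.ofReal_mul (p := 2) (by norm_num), ENNReal.ofReal_ofNat]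
    gcongr
    refine (lintegral_gauss_mul_expSum_le T _ hδ hε.le hε2 hκ).trans (le_of_eq ?_)
    rw [hJl]
  refine (lintegral_mono h2).trans ?_
  rw [lintegral_const_mul' _ _ ENNReal.ofReal_ne_top, lintegral_add_left measurable_const,
    lintegral_const_mul' _ _ ENNReal.ofReal_ne_top, ENNReal.ofReal_mul (p := 2 * J * _)
    (by positivity)]
  gcongr
  rw [ENNReal.ofReal_add (by positivity) (by positivity)]
  gcongr
  · rw [lintegral_const, Measure.restrict_apply_univ, Real.volume_Ioo, mul_comm,
      ENNReal.ofReal_mul (p := 2 * π) (by positivity),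
      ENNReal.ofReal_add (by positivity) (by positivity),
      ENNReal.ofReal_mul (q := J) (by positivity), ENNReal.ofReal_mul (p := 2) (q := (T.card : ℝ)) (by norm_num),
      ENNReal.ofReal_ofNat, ENNReal.ofReal_natCast, sub_neg_eq_add, ← two_mul]
  · rw [ENNReal.ofReal_mul hκ.le]
    gcongr
    exact lintegral_abs_mul_expSum_sq_le hδ hx

/-- The number of grid cells of side `δ` on which the energy can increase by `r` between the
scales `δ` and `δ / 2`. -/
lemma exists_card_bound {s β ε : ℝ} (hs : 0 ≤ s) (hβ : 0 ≤ β) (hβs : β ≤ s / 2)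
    (hε : 0 < ε) (hε2 : ε ≤ 2) (hsum : s - β = 1 + ε) (hβ2 : β ≤ 2)
    (hμ : ∀ ξ : Plane, ξ ≠ 0 → ‖measureFourier μ ξ‖ ≤ ‖ξ‖ ^ (-s / 2)) :
    ∃ D : ℝ, 0 < D ∧ ∀ δ r : ℝ, 0 < δ → D * δ ^ β ≤ r →
      ∀ (T : Finset (ℤ × ℤ)) (x : ℤ × ℤ → Plane), (∀ c ∈ T, gridCell δ (x c) = c) →
        (∀ c ∈ T, r ≤ radialEnergy μ (δ / 2) (x c) - radialEnergy μ δ (x c)) →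
        (T.card : ℝ) ≤ D * (δ ^ (2 * β - 2 - ε) / r ^ 2) := by
  set C : ℝ := (μ.real univ + 1) * 2 ^ (s / 2) with hC
  set J : ℝ := ∫ w : ℝ, (1 + |w|) ^ (-(1 + ε)) with hJ
  have hJ0 : 0 ≤ J := integral_nonneg fun w => by positivity
  obtain ⟨K, hK, hKJ, hKG, hK1⟩ : ∃ K : ℝ, 0 < K ∧ 2 * J * (6 * C ^ 2) * (2 * π * (64 * J)) ≤ K ∧
      2 * J * (6 * C ^ 2) * (16 * latticeSum ^ 2) ≤ K ∧ 2 * J * (6 * C ^ 2) * (4 * π) ≤ K :=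
    ⟨max 1 (max (2 * J * (6 * C ^ 2) * (2 * π * (64 * J)))
      (max (2 * J * (6 * C ^ 2) * (16 * latticeSum ^ 2)) (2 * J * (6 * C ^ 2) * (4 * π)))),
      by positivity, by simp, by simp, by simp⟩
  -- The entry `4 * K` lets the low-frequency term be absorbed into `N * r / 4`; the entry `8 * K ^
  -- 2` is the final constant.
  refine ⟨max (4 * K) (8 * K ^ 2), by positivity, fun δ r hδ hr T x hx hT => ?_⟩
  have hδβ : 0 < δ ^ β := rpow_pos_of_pos hδ _
  have hr4 : 4 * (K * δ ^ β) ≤ r := by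
    refine le_trans ?_ hr
    rw [← mul_assoc]
    gcongr
    exact le_max_left _ _
  have hr0 : 0 < r := lt_of_lt_of_le (by positivity) hr4
  -- Chosen so that the almost-orthogonality term equals exactly `N * r / 4`, also absorbed on the
  -- left.
  set κ : ℝ := r * δ ^ 2 / (4 * (K * δ ^ β)) with hκ
  have hκ0 : 0 < κ := by positivity
  have h := sum_radialEnergy_sub_le hs hβ hβs hε hε2 hsum hβ2
    (norm_projFourier_le_of_decay hs hμ) hδ hκ0 hx
  rw [← hJ, ← hC] at h
  have hl : T.card * r ≤ ∑ c ∈ T, (radialEnergy μ (δ / 2) (x c) - radialEnergy μ δ (x c)) := by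
    rw [← nsmul_eq_mul]
    exact Finset.card_nsmul_le_sum _ _ _ hT
  set N : ℝ := (T.card : ℝ) with hN
  have hN0 : 0 ≤ N := by positivity
  have h2 : N * r ≤ K * δ ^ β * N + K * δ ^ β * (κ⁻¹ * δ ^ (-ε)) +
      K * δ ^ β * (κ * δ⁻¹ ^ 2) * N := by
    refine (hl.trans h).trans ?_
    have t1 := mul_le_mul_of_nonneg_right hK1 (by positivity : 0 ≤ δ ^ β * N)
    have t2 := mul_le_mul_of_nonneg_right hKJ (by positivity : 0 ≤ δ ^ β * (κ⁻¹ * δ ^ (-ε)))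
    have t3 := mul_le_mul_of_nonneg_right hKG (by positivity : 0 ≤ δ ^ β * (κ * δ⁻¹ ^ 2) * N)
    linarith
  have e1 : K * δ ^ β * (κ * δ⁻¹ ^ 2) = r / 4 := by
    rw [hκ]; field_simp
  have e2 : K * δ ^ β * (κ⁻¹ * δ ^ (-ε)) = 4 * K ^ 2 * (δ ^ (2 * β - 2 - ε) / r) := by
    have : δ ^ (2 * β - 2 - ε) = δ ^ β * δ ^ β * (δ ^ 2)⁻¹ * δ ^ (-ε) := by
      rw [← rpow_natCast, ← rpow_neg hδ.le, ← rpow_add hδ, ← rpow_add hδ, ← rpow_add hδ]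
      congr 1
      push_cast
      ring
    rw [hκ, this]
    field_simp
  rw [e1, e2] at h2
  have h3 : N * r ≤ 8 * K ^ 2 * (δ ^ (2 * β - 2 - ε) / r) := by nlinarith
  have h4 : N ≤ 8 * K ^ 2 * (δ ^ (2 * β - 2 - ε) / r ^ 2) := by
    have : N ≤ 8 * K ^ 2 * (δ ^ (2 * β - 2 - ε) / r) / r := (le_div_iff₀ hr0).2 h3
    refine this.trans (le_of_eq ?_)
    field_simp
  refine h4.trans ?_
  gcongr
  exact le_max_right _ _

end

/-! ### Covering limsup sets by grid cells -/

lemma ediam_gridCell_le {δ : ℝ} (hδ : 0 < δ) (c : ℤ × ℤ) :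
    Metric.ediam {y : Plane | gridCell δ y = c} ≤ ENNReal.ofReal (2 * δ) := by
  refine Metric.ediam_le fun y hy z hz => ?_
  rw [edist_dist]
  refine ENNReal.ofReal_le_ofReal ?_
  have h : gridCell δ y = gridCell δ z := Eq.trans hy (Eq.symm hz)
  have h0 := Int.abs_sub_lt_one_of_floor_eq_floor (congrArg Prod.fst h)
  have h1 := Int.abs_sub_lt_one_of_floor_eq_floor (congrArg Prod.snd h)
  rw [← sub_div, abs_div, abs_of_pos hδ, div_lt_one hδ] at h0 h1
  rw [EuclideanSpace.dist_eq, Fin.sum_univ_two, Real.dist_eq, Real.dist_eq]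
  refine Real.sqrt_le_iff.2 ⟨by positivity, ?_⟩
  nlinarith [abs_nonneg (y 0 - z 0), abs_nonneg (y 1 - z 1)]

lemma exists_finset_of_card_le {α : Type*} {Z : Set α} {M : ℝ}
    (h : ∀ T : Finset α, ↑T ⊆ Z → (T.card : ℝ) ≤ M) :
    ∃ F : Finset α, Z ⊆ F ∧ (F.card : ℝ) ≤ M := by
  have hfin : Z.Finite := by
    by_contra hinf
    obtain ⟨T, hT, hc⟩ := Set.Infinite.exists_subset_card_eq hinf (⌊M⌋₊ + 1)
    have := h T hT
    rw [hc] at this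
    have := Nat.lt_floor_add_one M
    push_cast at *
    linarith
  exact ⟨hfin.toFinset, by simp, h _ (by simp)⟩

/-- Covering bound for the Hausdorff dimension of a limsup set. -/
lemma dimH_frequently_mem_le {B : ℕ → Set Plane} {a D : ℝ} {t : NNReal} (hD : 0 ≤ D)
    (hat : a < t)
    (h : ∀ᶠ j : ℕ in atTop, ∀ T : Finset (ℤ × ℤ),
      ↑T ⊆ gridCell ((1 / 2) ^ j) '' B j → (T.card : ℝ) ≤ D * ((1 / 2 : ℝ) ^ j) ^ (-a)) :
    dimH {x | ∃ᶠ j in atTop, x ∈ B j} ≤ t := by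
  obtain ⟨J, hJ⟩ := eventually_atTop.1 h
  have hF : ∀ j, ∃ F : Finset (ℤ × ℤ), J ≤ j → gridCell ((1 / 2) ^ j) '' B j ⊆ F ∧
      (F.card : ℝ) ≤ D * ((1 / 2 : ℝ) ^ j) ^ (-a) := by
    intro j
    by_cases hj : J ≤ j
    · obtain ⟨F, hF⟩ := exists_finset_of_card_le (hJ j hj)
      exact ⟨F, fun _ => hF⟩
    · exact ⟨∅, fun hj' => absurd hj' hj⟩
  choose F hF using hF
  -- The cells of generation `j` contribute `O(q ^ j)` to the `t`-dimensional sum, so the cover by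
  -- all generations from `n` on is summable.
  set q : ℝ := (1 / 2 : ℝ) ^ ((t : ℝ) - a) with hq
  have hq1 : q < 1 := rpow_lt_one (by norm_num) (by norm_num) (by linarith)
  have hq0 : 0 < q := by positivity
  apply dimH_le_of_hausdorffMeasure_ne_top
  have key := Measure.hausdorffMeasure_le_liminf_tsum (t : ℝ)
    {x : Plane | ∃ᶠ j in atTop, x ∈ B j} (l := atTop)
    (ι := fun n : ℕ => Σ j : ℕ, F (n + j)) (fun n : ℕ => ENNReal.ofReal (2 * (1 / 2) ^ n))
    ?_ (fun n i => {y : Plane | gridCell ((1 / 2) ^ (n + i.1)) y = i.2.1}) ?_ ?_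
  · refine ne_top_of_le_ne_top (b := ENNReal.ofReal (∑' j : ℕ, D * 2 ^ (t : ℝ) * q ^ j))
      ENNReal.ofReal_ne_top (key.trans ?_)
    refine liminf_le_of_frequently_le' (Eventually.frequently ?_)
    filter_upwards [eventually_ge_atTop J] with n hn
    have hterm : ∀ j : ℕ, ∑' c : F (n + j),
        Metric.ediam {y : Plane | gridCell ((1 / 2) ^ (n + j)) y = c.1} ^ (t : ℝ) ≤
        ENNReal.ofReal (D * 2 ^ (t : ℝ) * q ^ j) := by
      intro j
      have hδ : (0 : ℝ) < (1 / 2) ^ (n + j) := by positivity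
      have hc := (hF (n + j) (hn.trans (Nat.le_add_right n j))).2
      calc _ ≤ ∑' c : F (n + j), ENNReal.ofReal ((2 * (1 / 2) ^ (n + j)) ^ (t : ℝ)) := by
            refine ENNReal.tsum_le_tsum fun c => ?_
            rw [← ENNReal.ofReal_rpow_of_nonneg (by positivity) t.coe_nonneg]
            exact ENNReal.rpow_le_rpow (ediam_gridCell_le hδ c.1) t.coe_nonneg
        _ = ENNReal.ofReal ((F (n + j)).card * (2 * (1 / 2) ^ (n + j)) ^ (t : ℝ)) := by
            rw [tsum_fintype, Finset.sum_const, Finset.card_univ, Fintype.card_coe, nsmul_eq_mul,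
              ENNReal.ofReal_mul (by positivity), ENNReal.ofReal_natCast]
        _ ≤ ENNReal.ofReal (D * 2 ^ (t : ℝ) * q ^ j) := by
            refine ENNReal.ofReal_le_ofReal ?_
            calc _ ≤ (D * ((1 / 2 : ℝ) ^ (n + j)) ^ (-a)) * (2 * (1 / 2) ^ (n + j)) ^ (t : ℝ) := by
                  gcongr
              _ = D * 2 ^ (t : ℝ) * q ^ (n + j) := by
                  have : q ^ (n + j) = ((1 / 2 : ℝ) ^ (n + j)) ^ (t : ℝ) *
                      ((1 / 2 : ℝ) ^ (n + j)) ^ (-a) := by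
                    rw [← rpow_add hδ, hq, ← rpow_natCast, ← rpow_natCast, ← rpow_mul (by norm_num),
                      ← rpow_mul (by norm_num)]
                    congr 1
                    ring
                  rw [this, mul_rpow (by norm_num) hδ.le]
                  ring
              _ ≤ D * 2 ^ (t : ℝ) * q ^ j := by
                  gcongr 1
                  exact pow_le_pow_of_le_one hq0.le hq1.le (Nat.le_add_left j n)
    rw [ENNReal.tsum_sigma (fun (j : ℕ) (c : F (n + j)) =>
        Metric.ediam {y : Plane | gridCell ((1 / 2) ^ (n + j)) y = c.1} ^ (t : ℝ)),
      ENNReal.ofReal_tsum_of_nonneg (fun j => by positivity)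
      ((summable_geometric_of_lt_one hq0.le hq1).mul_left _)]
    exact ENNReal.tsum_le_tsum hterm
  · have h0 : Tendsto (fun n : ℕ => 2 * (1 / 2 : ℝ) ^ n) atTop (𝓝 (2 * 0)) :=
      (tendsto_pow_atTop_nhds_zero_of_lt_one (by norm_num) (by norm_num)).const_mul 2
    simpa using ENNReal.tendsto_ofReal h0
  · refine .of_forall fun n i => (ediam_gridCell_le (by positivity) _).trans ?_
    refine ENNReal.ofReal_le_ofReal ?_
    gcongr 2 * ?_
    exact pow_le_pow_of_le_one (by norm_num) (by norm_num) (Nat.le_add_right n i.1)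
  · filter_upwards [eventually_ge_atTop J] with n hn x hx
    obtain ⟨j, hj, hxj⟩ := frequently_atTop.1 hx n
    obtain ⟨k, rfl⟩ := Nat.exists_eq_add_of_le hj
    exact mem_iUnion.2 ⟨⟨k, gridCell ((1 / 2) ^ (n + k)) x,
      (hF (n + k) (by omega)).1 (mem_image_of_mem _ hxj)⟩, rfl⟩

/-! ### Null radial projections make the energy blow up -/

lemma abs_sub_le_two_mul_dist_dirVec {θ φ : ℝ} (h : |θ - φ| ≤ 1) :
    |θ - φ| ≤ 2 * dist (dirVec θ) (dirVec φ) := by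
  have h1 : dist (dirVec θ) (dirVec φ) ^ 2 = 2 - 2 * cos (θ - φ) := by
    rw [EuclideanSpace.dist_eq, sq_sqrt (by positivity), Fin.sum_univ_two, Real.dist_eq,
      Real.dist_eq, sq_abs, sq_abs, cos_sub]
    simp only [dirVec, Matrix.cons_val_zero, Matrix.cons_val_one]
    linear_combination sin_sq_add_cos_sq θ + sin_sq_add_cos_sq φ
  have h2 := cos_le_one_sub_mul_cos_sq (x := θ - φ) (by linarith [pi_gt_three])
  have h3 : 1 / 8 ≤ 2 / π ^ 2 := by
    rw [div_le_div_iff₀ (by norm_num) (by positivity)]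
    nlinarith [pi_le_four, pi_pos]
  have h4 : 1 / 8 * (θ - φ) ^ 2 ≤ 2 / π ^ 2 * (θ - φ) ^ 2 := by gcongr
  refine abs_le_of_sq_le_sq ?_ (by positivity)
  rw [mul_pow, h1]
  linarith

/-- The angular parametrisation is antilipschitz on intervals of length 1, so null sets pull back to
null sets there; countably many such intervals cover the line. -/
lemma volume_dirVec_preimage_eq_zero {A : Set Plane} (hA : μH[1] A = 0) :
    volume {θ | dirVec θ ∈ A} = 0 := by
  have h : {θ | dirVec θ ∈ A} ⊆
      ⋃ n : ℤ, ((↑) : Icc (n : ℝ) (n + 1) → ℝ) '' ((fun θ => dirVec θ.1) ⁻¹' A) := by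
    intro θ hθ
    exact mem_iUnion.2 ⟨⌊θ⌋, ⟨⟨θ, Int.floor_le θ, (Int.lt_floor_add_one θ).le⟩, hθ, rfl⟩⟩
  refine measure_mono_null h (measure_iUnion_null fun n => ?_)
  rw [← hausdorffMeasure_real, isometry_subtype_coe.hausdorffMeasure_image (.inl zero_le_one)]
  have hanti : AntilipschitzWith 2 (fun θ : Icc (n : ℝ) (n + 1) => dirVec θ.1) := by
    refine AntilipschitzWith.of_le_mul_dist fun θ φ => ?_
    rw [Subtype.dist_eq, Real.dist_eq]
    refine abs_sub_le_two_mul_dist_dirVec (abs_le.2 ⟨?_, ?_⟩) <;>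
      linarith [θ.2.1, θ.2.2, φ.2.1, φ.2.2]
  have := hanti.hausdorffMeasure_preimage_le zero_le_one A
  rw [hA, mul_zero] at this
  exact le_antisymm this zero_le

/-- A vector orthogonal to `(cos θ, sin θ)` is a multiple of its quarter turn; the sign of the
multiple is unknown, hence the alternative. -/
lemma dirVec_mem_radialProjection {E : Set Plane} {x y : Plane} {θ : ℝ} (hy : y ∈ E) (hyx : y ≠ x)
    (h : dirCoord θ (y - x) = 0) :
    dirVec (θ + π / 2) ∈ radialProjection x E ∨ dirVec (θ - π / 2) ∈ radialProjection x E := by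
  set v := x - y with hv
  have hv0 : 0 < ‖v‖ := norm_pos_iff.2 (sub_ne_zero.2 hyx.symm)
  have h0 : v 0 * cos θ + v 1 * sin θ = 0 := by
    rw [← neg_sub, ← hv] at h
    simp only [dirCoord, PiLp.neg_apply] at h
    linarith
  have hn : ‖v‖ ^ 2 = v 0 ^ 2 + v 1 ^ 2 := by
    rw [EuclideanSpace.norm_eq, sq_sqrt (by positivity), Fin.sum_univ_two, Real.norm_eq_abs,
      Real.norm_eq_abs, sq_abs, sq_abs]
  set l : ℝ := v 1 * cos θ - v 0 * sin θ with hl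
  have e0 : v 0 = -l * sin θ := by
    rw [hl]; linear_combination cos θ * h0 - v 0 * sin_sq_add_cos_sq θ
  have e1 : v 1 = l * cos θ := by
    rw [hl]; linear_combination sin θ * h0 - v 1 * sin_sq_add_cos_sq θ
  have hl2 : l ^ 2 = ‖v‖ ^ 2 := by
    rw [hn, e0, e1]; linear_combination - l ^ 2 * sin_sq_add_cos_sq θ
  have hmem : ‖v‖⁻¹ • v ∈ radialProjection x E := ⟨y, ⟨hy, hyx⟩, rfl⟩
  rcases sq_eq_sq_iff_eq_or_eq_neg.1 hl2 with hl' | hl'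
  · left
    convert hmem using 1
    ext i
    fin_cases i
    · simp [dirVec, e0, hl', cos_add_pi_div_two]; field_simp
    · simp [dirVec, e1, hl', sin_add_pi_div_two]; field_simp
  · right
    convert hmem using 1
    ext i
    fin_cases i
    · simp [dirVec, e0, hl', cos_sub_pi_div_two]; field_simp
    · simp [dirVec, e1, hl', sin_sub_pi_div_two]; field_simp

/-- The directions `θ` whose strip of half-width `δ` around `x` meets `K`. -/
def stripDirs (K : Set Plane) (x : Plane) (δ : ℝ) : Set ℝ :=
  {θ | θ ∈ Icc (-π) π ∧ ∃ y ∈ K, |dirCoord θ (y - x)| ≤ δ}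

lemma isCompact_stripDirs {K : Set Plane} (hK : IsCompact K) (x : Plane) (δ : ℝ) :
    IsCompact (stripDirs K x δ) := by
  have h : stripDirs K x δ = Prod.fst ''
      ((Icc (-π) π ×ˢ K) ∩ {q : ℝ × Plane | |dirCoord q.1 (q.2 - x)| ≤ δ}) := by
    ext θ
    simp [stripDirs, and_assoc]
  rw [h]
  exact ((isCompact_Icc.prod hK).inter_right (isClosed_le (by fun_prop) (by fun_prop))).image
    continuous_fst

lemma stripDirs_mono {K : Set Plane} {x : Plane} {δ δ' : ℝ} (h : δ ≤ δ') :
    stripDirs K x δ ⊆ stripDirs K x δ' :=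
  fun _ hθ => ⟨hθ.1, hθ.2.imp fun _ hy => ⟨hy.1, hy.2.trans h⟩⟩

lemma iInter_stripDirs_subset {K : Set Plane} (hK : IsCompact K) (x : Plane) :
    ⋂ n : ℕ, stripDirs K x (1 / (n + 1)) ⊆ {θ | ∃ y ∈ K, dirCoord θ (y - x) = 0} := by
  intro θ hθ
  rw [mem_iInter] at hθ
  obtain ⟨-, y₀, hy₀, -⟩ := hθ 0
  obtain ⟨y, hy, hmin⟩ := hK.exists_isMinOn ⟨y₀, hy₀⟩
    (f := fun y => |dirCoord θ (y - x)|) (Continuous.continuousOn (by fun_prop))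
  refine ⟨y, hy, abs_eq_zero.1 (le_antisymm ?_ (abs_nonneg _))⟩
  refine ge_of_tendsto' tendsto_one_div_add_atTop_nhds_zero_nat fun n => ?_
  obtain ⟨-, z, hz, hzn⟩ := hθ n
  exact (hmin hz).trans hzn

/-- The compact sets of directions decrease to those of lines through `x` that meet `K`. As `x ∉ K`,
these lie in two quarter turns of a null set of angles, and continuity from above applies. -/
lemma tendsto_volume_stripDirs {K E : Set Plane} {x : Plane} (hK : IsCompact K) (hKE : K ⊆ E)
    (hx : x ∉ K) (hE : μH[1] (radialProjection x E) = 0) :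
    Tendsto (fun n : ℕ => volume.real (stripDirs K x (1 / (n + 1)))) atTop (𝓝 0) := by
  have h1 := volume_dirVec_preimage_eq_zero hE
  have hnull : volume {θ | ∃ y ∈ K, dirCoord θ (y - x) = 0} = 0 := by
    have hsub : {θ | ∃ y ∈ K, dirCoord θ (y - x) = 0} ⊆
        (fun θ => θ + π / 2) ⁻¹' {θ | dirVec θ ∈ radialProjection x E} ∪
        (fun θ => θ - π / 2) ⁻¹' {θ | dirVec θ ∈ radialProjection x E} := by
      rintro θ ⟨y, hy, hθ⟩
      exact dirVec_mem_radialProjection (hKE hy) (fun h => hx (h ▸ hy)) hθ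
    refine measure_mono_null hsub (measure_union_null ?_ ?_)
    · rw [measure_preimage_add_right]; exact h1
    · simp_rw [sub_eq_add_neg]
      rw [measure_preimage_add_right]; exact h1
  have h := tendsto_measure_iInter_atTop (μ := volume)
    (s := fun n : ℕ => stripDirs K x (1 / (n + 1)))
    (fun n => (isCompact_stripDirs hK x _).measurableSet.nullMeasurableSet)
    (fun m n hmn => stripDirs_mono (by gcongr))
    ⟨0, (isCompact_stripDirs hK x _).measure_lt_top.ne⟩
  rw [measure_mono_null (iInter_stripDirs_subset hK x) hnull] at h
  have := (ENNReal.tendsto_toReal ENNReal.zero_ne_top).comp h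
  simpa [Measure.real, Function.comp_def] using this

/-- The coordinate takes opposite values at `-π` and `0`, so it vanishes at some `θ₀` between. It is
at most `‖v‖ * |θ - θ₀|`, so the interval of length `δ / R ≤ 1` to the right of `θ₀` works and stays
below `π`. -/
lemma le_volume_abs_dirCoord_le {v : Plane} {R δ : ℝ} (hv : ‖v‖ ≤ R) (hR : 0 < R) (hδR : δ ≤ R) :
    ENNReal.ofReal (δ / R) ≤ volume.restrict (Ioo (-π) π) {θ | |dirCoord θ v| ≤ δ} := by
  have hcont : Continuous fun θ => dirCoord θ v := by fun_prop
  obtain ⟨θ₀, hθ₀, hz⟩ : ∃ θ₀ ∈ Icc (-π) 0, dirCoord θ₀ v = 0 := by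
    have hpi : -π ≤ 0 := by linarith [pi_pos]
    have e1 : dirCoord (-π) v = -v 0 := by simp [dirCoord]
    have e2 : dirCoord 0 v = v 0 := by simp [dirCoord]
    rcases le_total (v 0) 0 with h | h
    · exact intermediate_value_Icc' hpi hcont.continuousOn
        (by rw [e1, e2]; constructor <;> linarith)
    · exact intermediate_value_Icc hpi hcont.continuousOn
        (by rw [e1, e2]; constructor <;> linarith)
  have hsub : Ioo θ₀ (θ₀ + δ / R) ⊆ {θ | |dirCoord θ v| ≤ δ} ∩ Ioo (-π) π := by
    intro θ hθ
    have hδ1 : δ / R ≤ 1 := (div_le_one hR).2 hδR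
    refine ⟨?_, by linarith [hθ.1, hθ₀.1], by linarith [hθ.2, hθ₀.2, pi_gt_three]⟩
    have h1 : |dirCoord θ v| ≤ ‖v‖ * |θ - θ₀| := by
      set l : ℝ := v 1 * cos θ₀ - v 0 * sin θ₀ with hl
      have hz' : v 0 * cos θ₀ + v 1 * sin θ₀ = 0 := hz
      have hn : ‖v‖ ^ 2 = v 0 ^ 2 + v 1 ^ 2 := by
        rw [EuclideanSpace.norm_eq, sq_sqrt (by positivity), Fin.sum_univ_two, Real.norm_eq_abs,
          Real.norm_eq_abs, sq_abs, sq_abs]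
      have hl2 : |l| = ‖v‖ := by
        rw [← abs_of_nonneg (norm_nonneg v), ← sq_eq_sq_iff_abs_eq_abs, hn, hl]
        linear_combination (v 0 ^ 2 + v 1 ^ 2) * sin_sq_add_cos_sq θ₀ -
          (v 0 * cos θ₀ + v 1 * sin θ₀) * hz'
      have e : dirCoord θ v = l * sin (θ - θ₀) := by
        have : θ = (θ - θ₀) + θ₀ := by ring
        rw [dirCoord]
        conv_lhs => rw [this, cos_add, sin_add]
        rw [hl]
        linear_combination cos (θ - θ₀) * hz'
      rw [e, abs_mul, hl2]
      exact mul_le_mul_of_nonneg_left abs_sin_le_abs (norm_nonneg v)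
    have h2 : |θ - θ₀| ≤ δ / R := by
      rw [abs_of_nonneg (by linarith [hθ.1])]; linarith [hθ.2]
    calc |dirCoord θ v| ≤ ‖v‖ * |θ - θ₀| := h1
      _ ≤ R * (δ / R) := by gcongr
      _ = δ := by field_simp
  rw [Measure.restrict_apply (isClosed_le (by fun_prop) (by fun_prop)).measurableSet]
  calc ENNReal.ofReal (δ / R) = volume (Ioo θ₀ (θ₀ + δ / R)) := by
        rw [Real.volume_Ioo]; congr 1; ring
    _ ≤ _ := measure_mono hsub

section
variable {μ : Measure Plane} [IsFiniteMeasure μ]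

lemma ofReal_mul_measure_strip_le {K : Set Plane} {x : Plane} {δ : ℝ} (hδ : 0 < δ) (θ : ℝ) :
    (μ.restrict K) {y | |dirCoord θ (y - x)| ≤ δ} ≤
      ENNReal.ofReal (δ * exp π * gaussProj μ δ θ x) := by
  have hm : MeasurableSet {y : Plane | |dirCoord θ (y - x)| ≤ δ} :=
    (isClosed_le (by fun_prop) (by fun_prop)).measurableSet
  have h1 : ENNReal.ofReal (δ⁻¹ * exp (-π)) * μ {y | |dirCoord θ (y - x)| ≤ δ} ≤
      ENNReal.ofReal (gaussProj μ δ θ x) := by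
    rw [gaussProj, ofReal_integral_eq_lintegral_ofReal (integrable_gaussProj hδ θ x)
      (.of_forall fun y => by positivity), ← setLIntegral_const]
    refine (setLIntegral_mono (by fun_prop) fun y hy => ?_).trans (setLIntegral_le_lintegral _ _)
    refine ENNReal.ofReal_le_ofReal ?_
    have hy' : |dirCoord θ y - dirCoord θ x| ≤ δ := by rw [← dirCoord_sub]; exact hy
    have hsq : (dirCoord θ y - dirCoord θ x) ^ 2 ≤ δ ^ 2 :=
      sq_le_sq' (abs_le.1 hy').1 (abs_le.1 hy').2
    gcongr
    rw [neg_mul, neg_div, neg_le_neg_iff, mul_div_assoc]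
    exact mul_le_of_le_one_right pi_pos.le ((div_le_one (by positivity)).2 hsq)
  calc (μ.restrict K) {y | |dirCoord θ (y - x)| ≤ δ}
      ≤ μ {y | |dirCoord θ (y - x)| ≤ δ} := Measure.restrict_le_self _
    _ = ENNReal.ofReal (δ * exp π) *
        (ENNReal.ofReal (δ⁻¹ * exp (-π)) * μ {y | |dirCoord θ (y - x)| ≤ δ}) := by
        rw [← mul_assoc, ← ENNReal.ofReal_mul (by positivity)]
        have : δ * exp π * (δ⁻¹ * exp (-π)) = 1 := by
          rw [exp_neg]; field_simp
        rw [this, ENNReal.ofReal_one, one_mul]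
    _ ≤ _ := by
        rw [ENNReal.ofReal_mul (q := gaussProj μ δ θ x) (by positivity)]
        gcongr

/-- Mass in strips is bounded below on average, and it lives on few directions. -/
lemma measure_le_volume_stripDirs_add_radialEnergy {K : Set Plane} {x : Plane} {R δ κ : ℝ}
    (hK : IsCompact K) (hKR : ∀ y ∈ K, ‖y - x‖ ≤ R) (hR : 0 < R) (hδ : 0 < δ) (hδR : δ ≤ R)
    (hκ : 0 < κ) :
    μ.real K / (R * exp π) ≤
      κ * volume.real (stripDirs K x δ) + κ⁻¹ * radialEnergy μ δ x := by
  set s : Set (ℝ × Plane) := {q | |dirCoord q.1 (q.2 - x)| ≤ δ} with hs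
  have hsm : MeasurableSet s := (isClosed_le (by fun_prop) (by fun_prop)).measurableSet
  have hE0 : 0 ≤ radialEnergy μ δ x := integral_nonneg fun θ => sq_nonneg _
  have hlow : μ K * ENNReal.ofReal (δ / R) ≤
      (volume.restrict (Ioo (-π) π)).prod (μ.restrict K) s := by
    rw [Measure.prod_apply_symm hsm, mul_comm, ← setLIntegral_const]
    refine setLIntegral_mono' hK.measurableSet fun y hy => ?_
    exact le_volume_abs_dirCoord_le (hKR y hy) hR hδR
  have hΘ : MeasurableSet (stripDirs K x δ) := (isCompact_stripDirs hK x δ).measurableSet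
  have hpt : ∀ θ ∈ Ioo (-π) π, (μ.restrict K) (Prod.mk θ ⁻¹' s) ≤
      ENNReal.ofReal (δ * exp π) * ((stripDirs K x δ).indicator (fun _ => ENNReal.ofReal κ) θ +
        ENNReal.ofReal κ⁻¹ * ENNReal.ofReal (gaussProj μ δ θ x ^ 2)) := by
    intro θ hθ
    by_cases hmem : θ ∈ stripDirs K x δ
    · refine (ofReal_mul_measure_strip_le hδ θ).trans ?_
      rw [indicator_of_mem hmem, ← ENNReal.ofReal_mul (by positivity),
        ← ENNReal.ofReal_add (by positivity) (by positivity), ← ENNReal.ofReal_mul (by positivity)]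
      refine ENNReal.ofReal_le_ofReal ?_
      gcongr
      set g := gaussProj μ δ θ x
      -- AM–GM with a free parameter `κ` takes the place of Cauchy–Schwarz in `θ`.
      have h : 0 ≤ κ⁻¹ * (g - κ / 2) ^ 2 := by positivity
      have e : κ⁻¹ * (g - κ / 2) ^ 2 = κ⁻¹ * g ^ 2 - g + κ / 4 := by field_simp; ring
      linarith
    · have h0 : (μ.restrict K) (Prod.mk θ ⁻¹' s) = 0 := by
        rw [Measure.restrict_apply (measurable_prodMk_left hsm)]
        convert measure_empty (μ := μ)
        refine eq_empty_of_forall_notMem fun y hy => hmem ⟨Ioo_subset_Icc_self hθ, y, hy.2, hy.1⟩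
      rw [h0]
      exact zero_le
  have hup : (volume.restrict (Ioo (-π) π)).prod (μ.restrict K) s ≤
      ENNReal.ofReal (δ * exp π) * (ENNReal.ofReal κ * volume (stripDirs K x δ) +
        ENNReal.ofReal κ⁻¹ * ENNReal.ofReal (radialEnergy μ δ x)) := by
    rw [Measure.prod_apply hsm]
    refine (setLIntegral_mono' measurableSet_Ioo hpt).trans ?_
    rw [lintegral_const_mul' _ _ ENNReal.ofReal_ne_top,
      lintegral_add_left (measurable_const.indicator hΘ),
      lintegral_const_mul' _ _ ENNReal.ofReal_ne_top, lintegral_indicator_const hΘ,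
      radialEnergy, ofReal_integral_eq_lintegral_ofReal (integrableOn_gaussProj_sq hδ x)
      (.of_forall fun θ => sq_nonneg _)]
    gcongr
    exact Measure.restrict_le_self
  have h := hlow.trans hup
  rw [← ofReal_measureReal (measure_ne_top μ K),
    ← ofReal_measureReal (isCompact_stripDirs hK x δ).measure_lt_top.ne,
    ← ENNReal.ofReal_mul (by positivity), ← ENNReal.ofReal_mul (by positivity),
    ← ENNReal.ofReal_mul (by positivity), ← ENNReal.ofReal_add (by positivity) (by positivity),
    ← ENNReal.ofReal_mul (by positivity), ENNReal.ofReal_le_ofReal_iff (by positivity)] at h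
  rw [div_le_iff₀ (by positivity)]
  have h' : δ * μ.real K ≤ δ * ((κ * volume.real (stripDirs K x δ) + κ⁻¹ * radialEnergy μ δ x) *
      (R * exp π)) := by
    have := mul_le_mul_of_nonneg_left h hR.le
    have e : R * (μ.real K * (δ / R)) = δ * μ.real K := by field_simp
    rw [e] at this
    linarith
  exact le_of_mul_le_mul_left h' hδ

/-- If the radial projection of `E` from `x` is null, the smoothed energies at `x` blow up. -/
lemma tendsto_radialEnergy_atTop {E : Set Plane} {x : Plane} (hc : IsCompact μ.support)
    (hsub : μ.support ⊆ E) (hx : μ {x}ᶜ ≠ 0) (hE : μH[1] (radialProjection x E) = 0) :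
    Tendsto (fun j : ℕ => radialEnergy μ ((1 / 2) ^ j) x) atTop atTop := by
  -- Every strip contains `x` itself, so a ball around `x` is removed while keeping positive mass.
  obtain ⟨n, hn⟩ : ∃ n : ℕ, 0 < μ (Metric.ball x (1 / (n + 1)))ᶜ := by
    apply exists_measure_pos_of_not_measure_iUnion_null
    convert hx
    ext y
    simp only [mem_iUnion, mem_compl_iff, Metric.mem_ball, not_lt, mem_singleton_iff]
    constructor
    · rintro ⟨n, h⟩ rfl
      rw [dist_self] at h
      exact absurd h (not_le.2 (by positivity))
    · intro h
      obtain ⟨n, hn⟩ := exists_nat_one_div_lt (dist_pos.2 h)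
      exact ⟨n, hn.le⟩
  set K : Set Plane := (Metric.ball x (1 / (n + 1)))ᶜ ∩ μ.support with hKdef
  have hK : IsCompact K := hc.inter_left Metric.isOpen_ball.isClosed_compl
  have hμK : 0 < μ.real K := by
    refine ENNReal.toReal_pos ?_ (measure_ne_top _ _)
    rw [hKdef, measure_inter_conull Measure.measure_compl_support]
    exact hn.ne'
  have hxK : x ∉ K := fun h => h.1 (Metric.mem_ball_self (by positivity))
  obtain ⟨R₀, hR₀⟩ := hK.isBounded.subset_closedBall x
  set R := max 1 R₀ with hRdef
  have hR1 : 1 ≤ R := le_max_left _ _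
  have hR : 0 < R := by linarith
  have hKR : ∀ y ∈ K, ‖y - x‖ ≤ R := by
    intro y hy
    rw [← dist_eq_norm]
    exact (Metric.mem_closedBall.1 (hR₀ hy)).trans (le_max_right _ _)
  have hb : 0 < μ.real K / (R * exp π) := by positivity
  set b := μ.real K / (R * exp π) with hbdef
  rw [tendsto_atTop]
  intro M
  set M' := max M 1 with hM'
  have hM'0 : 0 < M' := by positivity
  -- Once the strip term is at most `b / 2`, the energy is at least `κ * (b / 2) = M'`.
  set κ := 2 * M' / b with hκ
  have hκ0 : 0 < κ := by positivity
  obtain ⟨m, hm⟩ := ((tendsto_order.1 (tendsto_volume_stripDirs hK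
    (inter_subset_right.trans hsub) hxK hE)).2 (b / (2 * κ)) (by positivity)).exists
  have hev : ∀ᶠ j : ℕ in atTop, (1 / 2 : ℝ) ^ j < 1 / (m + 1) :=
    (tendsto_order.1 (tendsto_pow_atTop_nhds_zero_of_lt_one (by norm_num : (0 : ℝ) ≤ 1 / 2)
      (by norm_num))).2 _ (by positivity)
  filter_upwards [hev] with j hj
  have h := measure_le_volume_stripDirs_add_radialEnergy (μ := μ) hK hKR hR
    (δ := (1 / 2) ^ j) (by positivity) ((pow_le_one₀ (by norm_num) (by norm_num)).trans hR1) hκ0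
  have hv : volume.real (stripDirs K x ((1 / 2) ^ j)) ≤ b / (2 * κ) :=
    (measureReal_mono (stripDirs_mono hj.le)
      (isCompact_stripDirs hK x _).measure_lt_top.ne).trans hm.le
  have h1 : κ * volume.real (stripDirs K x ((1 / 2) ^ j)) ≤ b / 2 := by
    calc _ ≤ κ * (b / (2 * κ)) := by gcongr
      _ = b / 2 := by field_simp
  have h2 : b / 2 ≤ κ⁻¹ * radialEnergy μ ((1 / 2) ^ j) x := by linarith
  have h3 : κ * (b / 2) ≤ radialEnergy μ ((1 / 2) ^ j) x := by
    calc κ * (b / 2) ≤ κ * (κ⁻¹ * radialEnergy μ ((1 / 2) ^ j) x) := by gcongr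
      _ = _ := by field_simp
  have h4 : κ * (b / 2) = M' := by rw [hκ]; field_simp
  rw [h4] at h3
  exact (le_max_left _ _).trans h3

end

/-! ### The exceptional set and the theorem -/

lemma exists_forall_le_of_eventually_le_add_pow {u : ℕ → ℝ} {q : ℝ} (hq0 : 0 ≤ q) (hq1 : q < 1)
    (h : ∀ᶠ j in atTop, u (j + 1) ≤ u j + q ^ j) : ∃ M, ∀ᶠ j in atTop, u j ≤ M := by
  obtain ⟨J, hJ⟩ := eventually_atTop.1 h
  have hs := summable_geometric_of_lt_one hq0 hq1
  have hle : ∀ j, u (J + j) ≤ u J + ∑ i ∈ Finset.range j, q ^ (J + i) := by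
    intro j
    induction j with
    | zero => simp
    | succ j ih =>
      rw [Finset.sum_range_succ]
      have := hJ (J + j) (Nat.le_add_right J j)
      rw [← add_assoc]
      linarith
  refine ⟨u J + ∑' i : ℕ, q ^ i, eventually_atTop.2 ⟨J, fun j hj => ?_⟩⟩
  obtain ⟨k, rfl⟩ := Nat.exists_eq_add_of_le hj
  refine (hle k).trans ?_
  have h1 : ∑ i ∈ Finset.range k, q ^ (J + i) ≤ ∑ i ∈ Finset.range k, q ^ i :=
    Finset.sum_le_sum fun i _ => pow_le_pow_of_le_one hq0 hq1.le (Nat.le_add_left i J)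
  have h2 := hs.sum_le_tsum (Finset.range k) fun i _ => pow_nonneg hq0 i
  linarith

section
variable {μ : Measure Plane} [IsFiniteMeasure μ]

/-- The smoothed energies stay bounded off a set of dimension at most `4 - 2α`. -/
lemma dimH_not_bounded_radialEnergy_le {s α : ℝ} (hα : 1 < α) (hαs : α < s) (hs2 : s < 2)
    (hμ : ∀ ξ : Plane, ξ ≠ 0 → ‖measureFourier μ ξ‖ ≤ ‖ξ‖ ^ (-s / 2)) :
    dimH {x | ¬ ∃ M, ∀ᶠ j : ℕ in atTop, radialEnergy μ ((1 / 2) ^ j) x ≤ M} ≤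
      (4 - 2 * α).toNNReal := by
  set ε : ℝ := (s - α) / 8 with hε
  have hε0 : 0 < ε := by rw [hε]; linarith
  set β : ℝ := s - 1 - ε with hβ
  have hβε : ε < β := by rw [hβ, hε]; linarith
  obtain ⟨D, hD0, hD⟩ := exists_card_bound (μ := μ) (s := s) (β := β) (ε := ε) (by linarith)
    (by linarith) (by rw [hβ]; linarith) hε0 (by rw [hε]; linarith) (by rw [hβ]; ring)
    (by rw [hβ]; linarith) hμ
  set B : ℕ → Set Plane := fun j => {x | ((1 / 2 : ℝ) ^ j) ^ ε ≤
    radialEnergy μ ((1 / 2) ^ j / 2) x - radialEnergy μ ((1 / 2) ^ j) x} with hB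
  -- With increments of size `δ ^ ε` the counting exponent is `2 + 3ε - 2β = 4 - 2s + 5ε`; the
  -- choice `ε = (s - α) / 8` puts it below `4 - 2α`.
  have hat : 2 + 3 * ε - 2 * β < ((4 - 2 * α).toNNReal : ℝ) := by
    rw [coe_toNNReal _ (by linarith), hβ, hε]; linarith
  refine (dimH_mono ?_).trans (dimH_frequently_mem_le (B := B) hD0.le hat ?_)
  · intro x hx
    simp only [mem_ofPred_eq] at hx ⊢
    by_contra hcon
    refine hx (exists_forall_le_of_eventually_le_add_pow (q := (1 / 2) ^ ε) (by positivity)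
      (rpow_lt_one (by norm_num) (by norm_num) hε0) ?_)
    filter_upwards [not_frequently.1 hcon] with j hj
    simp only [hB, mem_ofPred_eq, not_le] at hj
    have e1 : ((1 / 2 : ℝ) ^ j) ^ ε = ((1 / 2 : ℝ) ^ ε) ^ j := by
      rw [← rpow_natCast, ← rpow_natCast, ← rpow_mul (by norm_num), ← rpow_mul (by norm_num),
        mul_comm]
    have e2 : (1 / 2 : ℝ) ^ (j + 1) = (1 / 2) ^ j / 2 := by ring
    rw [← e1, e2]
    linarith
  · have hlim : Tendsto (fun j : ℕ => D * ((1 / 2 : ℝ) ^ j) ^ (β - ε)) atTop (𝓝 0) := by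
      have h := ((tendsto_pow_atTop_nhds_zero_of_lt_one (by norm_num : (0 : ℝ) ≤ 1 / 2)
        (by norm_num)).rpow_const (p := β - ε) (.inr (by linarith))).const_mul D
      rwa [zero_rpow (by linarith), mul_zero] at h
    filter_upwards [(tendsto_order.1 hlim).2 1 one_pos] with j hj T hT
    set δ : ℝ := (1 / 2) ^ j with hδ
    have hδ0 : 0 < δ := by positivity
    have hx : ∀ c ∈ T, ∃ y, y ∈ B j ∧ gridCell δ y = c := fun c hc => hT hc
    choose! x hxB hxc using hx
    have hr : D * δ ^ β ≤ δ ^ ε := by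
      have : δ ^ β = δ ^ (β - ε) * δ ^ ε := by rw [← rpow_add hδ0]; congr 1; ring
      rw [this, ← mul_assoc]
      exact mul_le_of_le_one_left (by positivity) hj.le
    refine (hD δ (δ ^ ε) hδ0 hr T x hxc hxB).trans (le_of_eq ?_)
    congr 1
    rw [← rpow_natCast, ← rpow_mul hδ0.le, ← rpow_sub hδ0]
    congr 1
    push_cast
    ring

end

/-- Handles a measure concentrated at `x`, where the blow-up argument fails: at most one such point
exists, so dimension zero is added. -/
lemma subsingleton_setOf_measure_compl_singleton_eq_zero {μ : Measure Plane}
    (hμ : μ ≠ 0) :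
    {x : Plane | μ {x}ᶜ = 0}.Subsingleton := by
  intro x hx y hy
  by_contra hxy
  refine hμ (Measure.measure_univ_eq_zero.1 ?_)
  have h : (univ : Set Plane) = {x}ᶜ ∪ {y}ᶜ := by
    rw [← compl_inter, singleton_inter_eq_empty.2 (by simpa using hxy), compl_empty]
  rw [h]
  exact measure_union_null hx hy

lemma dimH_plane_le_two (E : Set Plane) : dimH E ≤ 2 := by
  refine (dimH_mono (subset_univ E)).trans (le_of_eq ?_)
  rw [Real.dimH_univ_eq_finrank]
  simp

/-- The exceptional set bound, for `α > 1`. -/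
lemma IsSalemSet.dimH_null_radialProjection_le {E : Set Plane} (hE : IsSalemSet E) {α : ℝ}
    (hα : 1 < α) (hαE : ENNReal.ofReal α < dimH E) :
    dimH {x : Plane | μH[1] (radialProjection x E) = 0} ≤ (4 - 2 * α).toNNReal := by
  have hd2 : dimH E ≤ 2 := dimH_plane_le_two E
  obtain ⟨d, hd⟩ : ∃ d : NNReal, (d : ℝ≥0∞) = dimH E :=
    ⟨_, ENNReal.coe_toNNReal (ne_top_of_le_ne_top (by norm_num) hd2)⟩
  rw [← hd] at hαE hd2
  have hαd : α < d := by
    rwa [← ENNReal.ofReal_coe_nnreal, ENNReal.ofReal_lt_ofReal_iff_of_nonneg (by linarith)]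
      at hαE
  have hd2' : (d : ℝ) ≤ 2 := by exact_mod_cast hd2
  obtain ⟨s, hαs, hsd⟩ := exists_between hαd
  obtain ⟨μ, hfin, hμ0, hcomp, hsub, hdecay⟩ := hE s (by linarith) (by
    rwa [← hd, ← ENNReal.ofReal_coe_nnreal, ENNReal.ofReal_lt_ofReal_iff_of_nonneg (by linarith)])
  have hcover : {x : Plane | μH[1] (radialProjection x E) = 0} ⊆
      {x | ¬ ∃ M, ∀ᶠ j : ℕ in atTop, radialEnergy μ ((1 / 2) ^ j) x ≤ M} ∪
        {x | μ {x}ᶜ = 0} := by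
    intro x hx
    by_cases hx0 : μ {x}ᶜ = 0
    · exact .inr hx0
    · left
      rintro ⟨M, hM⟩
      have h := tendsto_radialEnergy_atTop hcomp hsub hx0 hx
      obtain ⟨j, h1, h2⟩ := (hM.and (h.eventually_gt_atTop M)).exists
      exact absurd h1 (not_le.2 h2)
  refine (dimH_mono hcover).trans ?_
  rw [dimH_union, (subsingleton_setOf_measure_compl_singleton_eq_zero hμ0).dimH_zero]
  exact max_le (dimH_not_bounded_radialEnergy_le hα hαs (by linarith) hdecay) zero_le

end

theorem theorem1p5 (E : Set (EuclideanSpace ℝ (Fin 2))) (hE : IsSalemSet E) :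
    (∀ α : ℝ, (α : EReal) < ((dimH E : ℝ≥0∞) : EReal) →
      ((dimH {x : EuclideanSpace ℝ (Fin 2) | μH[1] (radialProjection x E) = 0} : ℝ≥0∞) : EReal)
        ≤ ((4 - 2 * α : ℝ) : EReal)) ∧
    ((4 / 3 : ℝ≥0∞) < dimH E →
      ∃ x ∈ E, 0 < μH[1] (radialProjection x E)) := by
  obtain ⟨d, hd⟩ : ∃ d : NNReal, (d : ℝ≥0∞) = dimH E :=
    ⟨_, ENNReal.coe_toNNReal (ne_top_of_le_ne_top (by norm_num) (dimH_plane_le_two E))⟩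
  have hd2 : (d : ℝ) ≤ 2 := by
    have := dimH_plane_le_two E
    rw [← hd] at this
    exact_mod_cast this
  have hlt : ∀ α : ℝ, 1 < α → α < d → ENNReal.ofReal α < dimH E := by
    intro α hα hαd
    rwa [← hd, ← ENNReal.ofReal_coe_nnreal,
      ENNReal.ofReal_lt_ofReal_iff_of_nonneg (by linarith)]
  constructor
  · intro α hα
    have hαd : α < d := by
      rwa [← hd, EReal.coe_nnreal_eq_coe_real, EReal.coe_lt_coe_iff] at hα
    have h : dimH {x : Plane | μH[1] (radialProjection x E) = 0} ≤
        ENNReal.ofReal (4 - 2 * α) := by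
      rcases le_or_gt α 1 with h1 | h1
      · refine (dimH_plane_le_two _).trans ?_
        rw [← ENNReal.ofReal_ofNat]
        exact ENNReal.ofReal_le_ofReal (by linarith)
      · exact hE.dimH_null_radialProjection_le h1 (hlt α h1 hαd)
    have h' := EReal.coe_ennreal_le_coe_ennreal_iff.2 h
    rwa [EReal.coe_ennreal_ofReal, max_eq_left (by linarith)] at h'
  · intro h43
    have h43d : (4 / 3 : ℝ) < d := by
      rw [← hd] at h43
      have h := ENNReal.toReal_strict_mono ENNReal.coe_ne_top h43
      simpa using h
    -- The threshold `4 / 3` is where `4 - 2 * α = α`: for this `α`, if all of `E` were exceptional,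
    -- then `d ≤ 4 - 2 * α < α < d`.
    obtain ⟨α, hα1, hα2⟩ := exists_between h43d
    by_contra! hcon
    have hsub : E ⊆ {x : Plane | μH[1] (radialProjection x E) = 0} :=
      fun x hx => le_antisymm (hcon x hx) zero_le
    have h := (dimH_mono hsub).trans
      (hE.dimH_null_radialProjection_le (by linarith) (hlt α (by linarith) hα2))
    rw [← hd, ENNReal.coe_le_coe, ← NNReal.coe_le_coe, Real.coe_toNNReal _ (by linarith)] at h
    linarith
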